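/- Let $n\ge 0$, let $\mathbb{E}^n=\mathbb{R}^n$ with the standard inner product, and let $\mathrm{Isom}(\mathbb{E}^n)$ be its isometry group. The Tits complex $\mathscr{T}(\mathbb{E}^n)$ is the simplicial set whose $k$-simplices are the chains $U_0\supseteq U_1\supseteq\dots\supseteq U_k$ of affine subspaces of $\mathbb{E}^n$, all different from $\emptyset$ and $\mathbb{E}^n$, with faces given by deletion and degeneracies by repetition of a subspace. Let $\tilde H_*(\mathscr{T}(\mathbb{E}^n),\mathbb{Z})$ be its reduced homology, i.e. the homology of the complex of simplicial chains augmented by $\mathbb{Z}$ in degree $-1$ (so that $\tilde H_{-1}(\emptyset)=\mathbb{Z}$). Let $\mathrm{Isom}(\mathbb{E}^n)$ act on it by the twisted action $$g\cdot c=\mathrm{sgn}(g)\,g_*(c),$$ where $g_*$ is induced by $(U_0\supseteq\dots\supseteq U_k)\mapsto(g(U_0)\supseteq\dots\supseteq g(U_k))$ and $\mathrm{sgn}(g)=\pm1$ is the sign of the determinant of the linear part of $g$. A geodesic $k$-simplex is the convex hull of $k+1$ affinely independent points. A polytope in $\mathbb{E}^n$ is a finite union of geodesic $n$-simplices any two of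 which have empty intersection or intersect in a geodesic $k$-simplex with $k<n$. The polytope module $\mathrm{Pt}(\mathbb{E}^n)$ is the abelian group generated by the symbols $[P]$, one for each polytope $P$ in $\mathbb{E}^n$, with the relations $[P]=[P']+[P'']$ whenever $P=P'\cup P''$ for polytopes $P,P',P''$ such that $P'\cap P''$ has no interior points; $\mathrm{Isom}(\mathbb{E}^n)$ acts on it by $g\cdot[P]=[g(P)]$. Theorem. There is an isomorphism of $\mathrm{Isom}(\mathbb{E}^n)$-modules $\tilde H_{n-1}(\mathscr{T}(\mathbb{E}^n),\mathbb{Z})\cong\mathrm{Pt}(\mathbb{E}^n)$, and $\tilde H_k(\mathscr{T}(\mathbb{E}^n),\mathbb{Z})=0$ for all $k\ne n-1$. -/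

import Mathlib

open CategoryTheory Limits Simplicial

noncomputable section

/-! ## Euclidean space and its isometries -/

/-- Euclidean `n`-space. -/
abbrev EuclSpace (n : ℕ) : Type := EuclideanSpace ℝ (Fin n)

/-- The group of all isometries of Euclidean `n`-space. -/
abbrev EuclIsom (n : ℕ) : Type := EuclSpace n ≃ᵢ EuclSpace n

/-- The affine map underlying an isometry. -/
def isomAffine {n : ℕ} (g : EuclIsom n) : EuclSpace n →ᵃ[ℝ] EuclSpace n :=
  g.toRealAffineIsometryEquiv.toAffineEquiv.toAffineMap

@[simp]
theorem isomAffine_apply {n : ℕ} (g : EuclIsom n) (x : EuclSpace n) : isomAffine g x = g x := rfl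

theorem isomAffine_one {n : ℕ} : isomAffine (1 : EuclIsom n) = AffineMap.id ℝ _ := by
  ext x; rfl

theorem isomAffine_mul {n : ℕ} (g h : EuclIsom n) :
    isomAffine (g * h) = (isomAffine g).comp (isomAffine h) := by
  ext x; rfl

/-- The sign of an isometry: the sign of the determinant of its linear part. -/
def isomSign (n : ℕ) : EuclIsom n →* ℤ where
  toFun g := ((SignType.sign (LinearMap.det (isomAffine g).linear) : SignType) : ℤ)
  map_one' := by
    rw [isomAffine_one, AffineMap.id_linear, LinearMap.det_id, sign_one]; rfl
  map_mul' g h := by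
    rw [isomAffine_mul, AffineMap.comp_linear, LinearMap.det_comp, sign_mul, SignType.coe_mul]

/-! ## The polytope module -/

/-- `s` is a geodesic `k`-simplex: the convex hull of `k + 1` affinely independent points. -/
def IsGeodesicSimplex {n : ℕ} (k : ℕ) (s : Set (EuclSpace n)) : Prop :=
  ∃ a : Fin (k + 1) → EuclSpace n, AffineIndependent ℝ a ∧ s = convexHull ℝ (Set.range a)

/-- A polytope is a finite union of geodesic `n`-simplices any two of which meet
in a geodesic `k`-simplex with `k < n` or not at all (the case `k = -1`). -/
def IsPolytope (n : ℕ) (P : Set (EuclSpace n)) : Prop :=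
  ∃ (m : ℕ) (Δ : Fin m → Set (EuclSpace n)),
    (∀ i, IsGeodesicSimplex n (Δ i)) ∧
    (∀ i j, i ≠ j → Δ i ∩ Δ j = ∅ ∨ ∃ k < n, IsGeodesicSimplex k (Δ i ∩ Δ j)) ∧
    P = ⋃ i, Δ i

theorem IsGeodesicSimplex.image {n k : ℕ} {s : Set (EuclSpace n)} (hs : IsGeodesicSimplex k s)
    (g : EuclIsom n) : IsGeodesicSimplex k (g '' s) := by
  obtain ⟨a, ha, rfl⟩ := hs
  refine ⟨isomAffine g ∘ a, ha.map' _ g.injective, ?_⟩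
  rw [Set.range_comp, ← AffineMap.image_convexHull]
  rfl

theorem IsPolytope.image {n : ℕ} {P : Set (EuclSpace n)} (hP : IsPolytope n P)
    (g : EuclIsom n) : IsPolytope n (g '' P) := by
  obtain ⟨m, Δ, h1, h2, rfl⟩ := hP
  refine ⟨m, fun i => g '' Δ i, fun i => (h1 i).image g, fun i j hij => ?_, Set.image_iUnion⟩
  simp only [← Set.image_inter g.injective]
  rcases h2 i j hij with h | ⟨k, hk, h⟩
  · left; rw [h, Set.image_empty]
  · exact Or.inr ⟨k, hk, h.image g⟩

/-- The type of polytopes in Euclidean `n`-space. -/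
def Polytope (n : ℕ) : Type := {P : Set (EuclSpace n) // IsPolytope n P}

/-- The image of a polytope under an isometry. -/
def Polytope.map {n : ℕ} (g : EuclIsom n) (P : Polytope n) : Polytope n :=
  ⟨g '' P.1, P.2.image g⟩

/-- `P = P' ∐ P''` up to boundary: `P = P' ∪ P''` and `P' ∩ P''` has no interior points. -/
def Polytope.IsDecomp {n : ℕ} (P P' P'' : Polytope n) : Prop :=
  P.1 = P'.1 ∪ P''.1 ∧ interior (P'.1 ∩ P''.1) = ∅

theorem Polytope.IsDecomp.map {n : ℕ} {P P' P'' : Polytope n} (h : P.IsDecomp P' P'')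
    (g : EuclIsom n) : (P.map g).IsDecomp (P'.map g) (P''.map g) := by
  refine ⟨by simp only [Polytope.map, h.1, Set.image_union], ?_⟩
  simp only [Polytope.map, ← Set.image_inter g.injective]
  have := g.toHomeomorph.image_interior (P'.1 ∩ P''.1)
  rw [h.2, Set.image_empty] at this
  exact this.symm

/-- The subgroup generated by the elements `[P] - ([P'] + [P''])`
with `P = P' ∐ P''` up to boundary. -/
def polytopeRelations (n : ℕ) : Submodule ℤ (Polytope n →₀ ℤ) :=
  Submodule.span ℤ {x | ∃ P P' P'' : Polytope n, P.IsDecomp P' P'' ∧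
    x = Finsupp.single P 1 - (Finsupp.single P' 1 + Finsupp.single P'' 1)}

/-- The polytope module `Pt(𝔼ⁿ)` as an abelian group. -/
abbrev PolytopeModule (n : ℕ) : Type := (Polytope n →₀ ℤ) ⧸ polytopeRelations n

theorem polytopeRelations_le {n : ℕ} (g : EuclIsom n) :
    polytopeRelations n ≤
      (polytopeRelations n).comap (Finsupp.lmapDomain ℤ ℤ (Polytope.map g)) := by
  refine Submodule.span_le.2 ?_
  rintro _ ⟨P, P', P'', h, rfl⟩
  refine Submodule.subset_span ⟨P.map g, P'.map g, P''.map g, h.map g, ?_⟩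
  simp only [map_sub, map_add, Finsupp.lmapDomain_apply, Finsupp.mapDomain_single]

/-- The action of isometries on `Pt(𝔼ⁿ)`, given by `g • [P] = [g(P)]`. -/
def polytopeRep (n : ℕ) : Representation ℤ (EuclIsom n) (PolytopeModule n) where
  toFun g := (polytopeRelations n).mapQ (polytopeRelations n)
    (Finsupp.lmapDomain ℤ ℤ (Polytope.map g)) (polytopeRelations_le g)
  map_one' := by
    have h : Polytope.map (1 : EuclIsom n) = id := by
      funext P; exact Subtype.ext (Set.image_id _)
    ext P
    simp [h]
  map_mul' g h := by
    have h : Polytope.map (g * h) = Polytope.map g ∘ Polytope.map h := by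
      funext P; exact Subtype.ext (Set.image_comp g h _)
    ext P
    simp [h]

/-! ## Reduced homology of a simplicial set -/

/-- The augmentation `C₀(X) ⟶ ℤ`, sending every vertex to `1`. -/
def simplicialAugmentation (X : SSet.{0}) :
    (X.chainComplex (ModuleCat.of ℤ ℤ)).X 0 ⟶ ModuleCat.of ℤ ℤ :=
  Sigma.desc fun _ => 𝟙 _

theorem ι_simplicialAugmentation (X : SSet.{0}) (x : X _⦋0⦌) :
    X.ιChainComplex x ≫ simplicialAugmentation X = 𝟙 (ModuleCat.of ℤ ℤ) := by
  exact Sigma.ι_desc _ _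

theorem d_simplicialAugmentation (X : SSet.{0}) :
    (X.chainComplex (ModuleCat.of ℤ ℤ)).d 1 0 ≫ simplicialAugmentation X = 0 := by
  refine SSet.chainComplex_hom_ext fun x => ?_
  rw [← Category.assoc, SSet.ιChainComplex_d, Preadditive.sum_comp, Fin.sum_univ_two]
  simp [ι_simplicialAugmentation]

/-- The augmented chain complex `⋯ ⟶ C₁(X) ⟶ C₀(X) ⟶ ℤ` of a simplicial set, with `ℤ`
placed in index `0` and the simplicial chains `C_k(X)` placed in index `k + 1`. -/
def augmentedChainComplex (X : SSet.{0}) : ChainComplex (ModuleCat.{0} ℤ) ℕ :=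
  (X.chainComplex (ModuleCat.of ℤ ℤ)).augment (simplicialAugmentation X)
    (d_simplicialAugmentation X)

/-- The map of augmented chain complexes induced by a map of simplicial sets. -/
def augmentedChainComplexMap {X Y : SSet.{0}} (f : X ⟶ Y) :
    augmentedChainComplex X ⟶ augmentedChainComplex Y where
  f
    | 0 => 𝟙 (ModuleCat.of ℤ ℤ)
    | k + 1 => (SSet.chainComplexMap f (ModuleCat.of ℤ ℤ)).f k
  comm' := by
    rintro _ (_ | j) rfl
    · refine SSet.chainComplex_hom_ext fun x => ?_
      change X.ιChainComplex x ≫ (SSet.chainComplexMap f (ModuleCat.of ℤ ℤ)).f 0 ≫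
        simplicialAugmentation Y = X.ιChainComplex x ≫ simplicialAugmentation X ≫ 𝟙 _
      rw [SSet.ι_chainComplexMap_f_assoc, Category.comp_id, ι_simplicialAugmentation,
        ι_simplicialAugmentation]
    · exact (SSet.chainComplexMap f (ModuleCat.of ℤ ℤ)).comm (j + 1) j

theorem augmentedChainComplexMap_id (X : SSet.{0}) :
    augmentedChainComplexMap (𝟙 X) = 𝟙 (augmentedChainComplex X) := by
  ext1 k
  cases k with
  | zero => rfl
  | succ k =>
    change (SSet.chainComplexMap (𝟙 X) (ModuleCat.of ℤ ℤ)).f k = 𝟙 _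
    rw [SSet.chainComplexMap, CategoryTheory.Functor.map_id]; rfl

theorem augmentedChainComplexMap_comp {X Y Z : SSet.{0}} (f : X ⟶ Y) (g : Y ⟶ Z) :
    augmentedChainComplexMap (f ≫ g) =
      augmentedChainComplexMap f ≫ augmentedChainComplexMap g := by
  ext1 k
  cases k with
  | zero => exact (Category.comp_id _).symm
  | succ k =>
    change (SSet.chainComplexMap (f ≫ g) (ModuleCat.of ℤ ℤ)).f k = _
    rw [SSet.chainComplexMap, CategoryTheory.Functor.map_comp]; rfl

/-- `shiftedReducedHomology X m` is the reduced integral homology of `X` in degree `m - 1`;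
thus `m = 0` gives degree `-1`, which is nonzero exactly if `X` is empty. -/
abbrev shiftedReducedHomology (X : SSet.{0}) (m : ℕ) : ModuleCat.{0} ℤ :=
  (augmentedChainComplex X).homology m

/-- The map in reduced homology induced by a map of simplicial sets. -/
abbrev shiftedReducedHomologyMap {X Y : SSet.{0}} (f : X ⟶ Y) (m : ℕ) :
    shiftedReducedHomology X m ⟶ shiftedReducedHomology Y m :=
  HomologicalComplex.homologyMap (augmentedChainComplexMap f) m

/-! ## The Tits complex -/

/-- The affine subspaces of Euclidean `n`-space other than `∅` and the whole space,
ordered by inclusion. -/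
abbrev ProperFlat (n : ℕ) : Type := {U : AffineSubspace ℝ (EuclSpace n) // U ≠ ⊥ ∧ U ≠ ⊤}

/-- The Tits complex: its `k`-simplices are the chains `U₀ ⊇ ⋯ ⊇ U_k` of affine subspaces
other than `∅` and the whole space, and its faces and degeneracies delete and repeat
subspaces. It is the nerve of the opposite of the poset `ProperFlat n`. -/
def titsComplex (n : ℕ) : SSet.{0} := nerve (ProperFlat n)ᵒᵈ

theorem isomAffine_bijective {n : ℕ} (g : EuclIsom n) : Function.Bijective (isomAffine g) :=
  g.bijective

/-- The image `g(U)` of an affine subspace under an isometry. -/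
def ProperFlat.map {n : ℕ} (g : EuclIsom n) (U : ProperFlat n) : ProperFlat n :=
  ⟨U.1.map (isomAffine g), by
    refine ⟨fun h => U.2.1 ((AffineSubspace.map_eq_bot_iff _).1 h), fun h => U.2.2 ?_⟩
    refine eq_top_iff.2 fun x _ => ?_
    have hx : isomAffine g x ∈ U.1.map (isomAffine g) := by
      rw [h]; exact AffineSubspace.mem_top ℝ _ _
    exact (AffineSubspace.mem_map_iff_mem_of_injective (isomAffine_bijective g).1).1 hx⟩

/-- The functor on the poset of flats, ordered by reverse inclusion, given by an isometry. -/
def flatFunctor {n : ℕ} (g : EuclIsom n) : (ProperFlat n)ᵒᵈ ⥤ (ProperFlat n)ᵒᵈ :=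
  Monotone.functor (f := fun U => OrderDual.toDual (ProperFlat.map g (OrderDual.ofDual U)))
    fun _ _ h => AffineSubspace.map_mono (isomAffine g) h

/-- The automorphism of the Tits complex given by an isometry:
`(U₀ ⊇ ⋯ ⊇ U_k) ↦ (g(U₀) ⊇ ⋯ ⊇ g(U_k))`. -/
def titsMap {n : ℕ} (g : EuclIsom n) : titsComplex n ⟶ titsComplex n := nerveMap (flatFunctor g)

theorem titsMap_one (n : ℕ) : titsMap (1 : EuclIsom n) = 𝟙 (titsComplex n) := by
  have h : flatFunctor (1 : EuclIsom n) = 𝟭 _ := by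
    refine CategoryTheory.Functor.ext (fun U => ?_) (fun _ _ _ => Subsingleton.elim _ _)
    refine Subtype.ext ?_
    change AffineSubspace.map (isomAffine 1) _ = _
    rw [isomAffine_one, AffineSubspace.map_id]; rfl
  rw [titsMap, h]; rfl

theorem titsMap_mul {n : ℕ} (g h : EuclIsom n) : titsMap (g * h) = titsMap h ≫ titsMap g := by
  have e : flatFunctor (g * h) = flatFunctor h ⋙ flatFunctor g := by
    refine CategoryTheory.Functor.ext (fun U => ?_) (fun _ _ _ => Subsingleton.elim _ _)
    refine Subtype.ext ?_
    change AffineSubspace.map (isomAffine (g * h)) _ = _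
    rw [isomAffine_mul, ← AffineSubspace.map_map]; rfl
  rw [titsMap, e]; rfl

/-- The reduced homology of the Tits complex in degree `m - 1`. -/
abbrev TitsHomology (n m : ℕ) : Type := shiftedReducedHomology (titsComplex n) m

/-- The action of isometries on the reduced homology of the Tits complex in degree `m - 1`
induced by the action on flags. -/
def titsRep (n m : ℕ) : Representation ℤ (EuclIsom n) (TitsHomology n m) where
  toFun g := (shiftedReducedHomologyMap (titsMap g) m).hom
  map_one' := by
    rw [titsMap_one, shiftedReducedHomologyMap, augmentedChainComplexMap_id,
      HomologicalComplex.homologyMap_id]; rfl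
  map_mul' g h := by
    rw [titsMap_mul, shiftedReducedHomologyMap, augmentedChainComplexMap_comp,
      HomologicalComplex.homologyMap_comp]; rfl

/-- The twist of a representation of the isometry group by the sign of isometries:
`g` acts as `sgn(g)` times its original action. -/
def signTwist {n : ℕ} {M : Type} [AddCommGroup M] [Module ℤ M]
    (ρ : Representation ℤ (EuclIsom n) M) :
    Representation ℤ (EuclIsom n) M where
  toFun g := isomSign n g • ρ g
  map_one' := by simp
  map_mul' g h := by
    simp only [map_mul, smul_mul_smul_comm]

end

/-! Flags are viewed inside the complexes of all tuples of points or of flats. There every cycle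
bounds a cone over it, and the method of acyclic carriers gives explicit chain maps (`coneMap`) and
homotopies (`coneHomotopy`) with controlled supports. Chains are indexed by tuple length, so length
`m` is simplicial degree `m - 1`.

Choosing a point `a U` in every nonempty flat `U` turns flags into tuples of points; `subdivide`
turns tuples of points into flags of their spans. On flags the composite is homotopic to the
identity through flags. At most `n` points span a proper flat, so for `m < n` a cycle can be pushed
to points, coned off and subdivided back, hence bounds. For `m > n` every flag has a repetition, and
`collapse`, which is homotopic to the identity, kills it.

For `m = n`, `evalFlag` sends a cycle to the sum of the oriented simplices with vertices `p, a U₀,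
…, a U_{n-1}`. Two facts make this work: the alternating sum of the faces of `n + 2` points is zero
in the polytope module (`sum_simplexClass_eq_zero`), and simplices inside a proper flat count as
zero. They show that boundaries go to zero and that `p` and `a` do not matter, whence equivariance
up to sign. Surjectivity holds because the subdivided boundary of a simplex is sent to that simplex
(`exists_evalFlag_eq_simplexClass`).

Injectivity uses `jump`. A full flag `w` has `2 ^ n` sectors around it, each tested by the germ of a
curve; the alternating sum of these tests is a functional on polytopes. If the points are generic
with respect to `w`, it returns the coefficient of `w` up to sign (`exists_jump_evalFlag`). A cycle
of class zero is thus supported on degenerate flags, and bounds. -/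

noncomputable section

/-! ## Chains of tuples -/

/-- Integral chains of `m`-tuples in `P`. -/
abbrev TupleChain (m : ℕ) (P : Type) : Type := (Fin m → P) →₀ ℤ

namespace TupleChain

variable {P Q : Type}

/-- Linear maps out of a module of tuple chains, given by their values on tuples. -/
abbrev lift {m : ℕ} {M : Type} [AddCommGroup M] (f : (Fin m → P) → M) :
    TupleChain m P →ₗ[ℤ] M :=
  Finsupp.linearCombination ℤ f

theorem lift_single {m : ℕ} {M : Type} [AddCommGroup M] (f : (Fin m → P) → M)
    (u : Fin m → P) : lift f (Finsupp.single u 1) = f u := by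
  simp

/-- The alternating sum of the faces of a tuple. -/
def d (m : ℕ) : TupleChain (m + 1) P →ₗ[ℤ] TupleChain m P :=
  lift fun u => ∑ i : Fin (m + 1), (-1 : ℤ) ^ (i : ℕ) • Finsupp.single (u ∘ i.succAbove) 1

theorem d_single {m : ℕ} (u : Fin (m + 1) → P) :
    d m (Finsupp.single u 1) =
      ∑ i : Fin (m + 1), (-1 : ℤ) ^ (i : ℕ) • Finsupp.single (u ∘ i.succAbove) 1 :=
  lift_single _ u

/-- The cone operator, putting the point `p` in front of a tuple. -/
def cone {m : ℕ} (p : P) : TupleChain m P →ₗ[ℤ] TupleChain (m + 1) P :=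
  lift fun u => Finsupp.single (Fin.cons p u) 1

@[simp]
theorem cone_single {m : ℕ} (p : P) (u : Fin m → P) :
    cone p (Finsupp.single u 1) = Finsupp.single (Fin.cons p u : Fin (m + 1) → P) 1 :=
  lift_single _ u

/-- The map of chains induced by a map of the vertices. -/
def push {m : ℕ} (f : P → Q) : TupleChain m P →ₗ[ℤ] TupleChain m Q :=
  lift fun u => Finsupp.single (f ∘ u) 1

@[simp]
theorem push_single {m : ℕ} (f : P → Q) (u : Fin m → P) :
    push f (Finsupp.single u 1) = Finsupp.single (f ∘ u) 1 :=
  lift_single _ u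

theorem hom_ext {m : ℕ} {M : Type} [AddCommGroup M] {f g : TupleChain m P →ₗ[ℤ] M}
    (h : ∀ u, f (Finsupp.single u 1) = g (Finsupp.single u 1)) : f = g := by
  ext u; exact h u

/-- Every nonempty tuple is a cone over its tail; this allows induction on length using only the
boundary formula for cones. -/
theorem hom_ext_cons {m : ℕ} {M : Type} [AddCommGroup M] {f g : TupleChain (m + 1) P →ₗ[ℤ] M}
    (h : ∀ p z, f (cone p z) = g (cone p z)) : f = g := by
  refine hom_ext fun u => ?_
  have := h (u 0) (Finsupp.single (Fin.tail u) 1)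
  rwa [cone_single, Fin.cons_self_tail] at this

theorem d_cone_zero (p : P) (z : TupleChain 0 P) : d 0 (cone p z) = z := by
  suffices h : d 0 ∘ₗ cone p = LinearMap.id from LinearMap.congr_fun h z
  refine hom_ext fun u => ?_
  simp only [LinearMap.comp_apply, cone_single, d_single, LinearMap.id_apply]
  rw [Fin.sum_univ_one]
  simp [Subsingleton.elim _ u]

/-- Deleting the apex gives back the chain; every other deletion happens in the base, at an index
shifted by one, hence the minus sign. -/
theorem d_cone {m : ℕ} (p : P) (z : TupleChain (m + 1) P) :
    d (m + 1) (cone p z) = z - cone p (d m z) := by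
  suffices h : d (m + 1) ∘ₗ cone p = LinearMap.id - cone p ∘ₗ d m from
    LinearMap.congr_fun h z
  refine hom_ext fun u => ?_
  simp only [LinearMap.comp_apply, cone_single, d_single, LinearMap.id_apply,
    LinearMap.sub_apply, map_sum, map_smul]
  rw [Fin.sum_univ_succ, sub_eq_add_neg, ← Finset.sum_neg_distrib]
  congr 1
  · simp only [Fin.val_zero, pow_zero, one_smul]
    congr 1
  · refine Finset.sum_congr rfl fun i _ => ?_
    rw [Fin.val_succ, pow_succ, mul_neg_one, neg_smul]
    have e : (Fin.cons p u : Fin (m + 2) → P) ∘ i.succ.succAbove =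
        Fin.cons p (u ∘ i.succAbove) := by
      funext j
      refine Fin.cases ?_ (fun j => ?_) j <;> simp
    rw [e]

theorem d_d (m : ℕ) (z : TupleChain (m + 2) P) : d m (d (m + 1) z) = 0 := by
  suffices h : d m ∘ₗ d (m + 1) = (0 : TupleChain (m + 2) P →ₗ[ℤ] _) from
    LinearMap.congr_fun h z
  clear z
  induction m with
  | zero =>
    refine hom_ext_cons fun p z => ?_
    simp [d_cone, d_cone_zero]
  | succ m ih =>
    refine hom_ext_cons fun p z => ?_
    have := LinearMap.congr_fun ih z
    simp only [LinearMap.comp_apply, LinearMap.zero_apply] at this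
    simp [d_cone, this]

/-- The cycles among the chains of `m`-tuples. -/
def IsCycle {m : ℕ} (z : TupleChain m P) : Prop :=
  match m, z with
  | 0, _ => True
  | m + 1, z => d m z = 0

/-- A family of maps of tuple chains commuting with the boundary. -/
def IsChainMap (φ : ∀ m, TupleChain m P →ₗ[ℤ] TupleChain m Q) : Prop :=
  ∀ m z, d m (φ (m + 1) z) = φ m (d m z)

theorem IsCycle.map {φ : ∀ m, TupleChain m P →ₗ[ℤ] TupleChain m Q} (hφ : IsChainMap φ)
    {m : ℕ} {z : TupleChain m P} (hz : IsCycle z) : IsCycle (φ m z) := by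
  cases m with
  | zero => trivial
  | succ m =>
    change d m z = 0 at hz
    change d m (φ (m + 1) z) = 0
    rw [hφ, hz, map_zero]

theorem isChainMap_push (f : P → Q) : IsChainMap fun _ => push f := by
  intro m z
  suffices h : d m ∘ₗ push f = push f ∘ₗ d m from LinearMap.congr_fun h z
  refine hom_ext fun u => ?_
  simp only [LinearMap.comp_apply, push_single, d_single, Function.comp_assoc, map_sum, map_smul]

/-- Every cycle is the boundary of a cone over it. -/
theorem IsCycle.d_cone {m : ℕ} {z : TupleChain m P} (hz : IsCycle z) (p : P) :
    d m (cone p z) = z := by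
  cases m with
  | zero => exact d_cone_zero p z
  | succ m =>
    change d m z = 0 at hz
    rw [TupleChain.d_cone, hz, map_zero, sub_zero]

theorem isCycle_d {m : ℕ} (z : TupleChain (m + 1) P) : IsCycle (d m z) := by
  cases m with
  | zero => trivial
  | succ m => exact d_d m z

/-! ### Chain maps and homotopies built from cones -/

/-- The chain map which sends a tuple `u` to the cone with apex `q u` over the image of the
boundary of `u`. -/
def coneMap (q : ∀ m, (Fin (m + 1) → P) → Q) (m : ℕ) : TupleChain m P →ₗ[ℤ] TupleChain m Q :=
  match m with
  | 0 => lift fun _ => Finsupp.single Fin.elim0 1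
  | m + 1 => lift fun u => cone (q m u) (coneMap q m (d m (Finsupp.single u 1)))

theorem coneMap_succ_single (q : ∀ m, (Fin (m + 1) → P) → Q) {m : ℕ} (u : Fin (m + 1) → P) :
    coneMap q (m + 1) (Finsupp.single u 1) =
      cone (q m u) (coneMap q m (d m (Finsupp.single u 1))) :=
  lift_single _ u

/-- By induction the image of the boundary of `u` is a cycle, so it is the boundary of the cone over
it. -/
theorem isChainMap_coneMap (q : ∀ m, (Fin (m + 1) → P) → Q) : IsChainMap (coneMap q) := by
  intro m z
  suffices h : d m ∘ₗ coneMap q (m + 1) = coneMap q m ∘ₗ d m from LinearMap.congr_fun h z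
  clear z
  induction m with
  | zero =>
    refine hom_ext fun u => ?_
    simp only [LinearMap.comp_apply, coneMap_succ_single, d_cone_zero]
  | succ m ih =>
    refine hom_ext fun u => ?_
    have := LinearMap.congr_fun ih (d (m + 1) (Finsupp.single u 1))
    simp only [LinearMap.comp_apply] at this
    simp only [LinearMap.comp_apply, coneMap_succ_single, TupleChain.d_cone]
    rw [this, d_d]
    simp

/-- The chain homotopy which sends a tuple `u` to a cone with apex `q u`. -/
def coneHomotopy (φ ψ : ∀ m, TupleChain m P →ₗ[ℤ] TupleChain m Q)
    (q : ∀ m, (Fin (m + 1) → P) → Q) (m : ℕ) : TupleChain m P →ₗ[ℤ] TupleChain (m + 1) Q :=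
  match m with
  | 0 => 0
  | m + 1 => lift fun u => cone (q m u) (φ (m + 1) (Finsupp.single u 1) -
      ψ (m + 1) (Finsupp.single u 1) - coneHomotopy φ ψ q m (d m (Finsupp.single u 1)))

theorem coneHomotopy_succ_single (φ ψ : ∀ m, TupleChain m P →ₗ[ℤ] TupleChain m Q)
    (q : ∀ m, (Fin (m + 1) → P) → Q) {m : ℕ} (u : Fin (m + 1) → P) :
    coneHomotopy φ ψ q (m + 1) (Finsupp.single u 1) =
      cone (q m u) (φ (m + 1) (Finsupp.single u 1) -
      ψ (m + 1) (Finsupp.single u 1) - coneHomotopy φ ψ q m (d m (Finsupp.single u 1))) :=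
  lift_single _ u

/-- The chain being coned off is a cycle by induction. The homotopy vanishes on empty tuples, which
is why the two maps must agree there. -/
theorem d_coneHomotopy {φ ψ : ∀ m, TupleChain m P →ₗ[ℤ] TupleChain m Q} (hφ : IsChainMap φ)
    (hψ : IsChainMap ψ) (h0 : φ 0 = ψ 0) (q : ∀ m, (Fin (m + 1) → P) → Q) {m : ℕ}
    (z : TupleChain (m + 1) P) :
    d (m + 1) (coneHomotopy φ ψ q (m + 1) z) =
      φ (m + 1) z - ψ (m + 1) z - coneHomotopy φ ψ q m (d m z) := by
  suffices h : d (m + 1) ∘ₗ coneHomotopy φ ψ q (m + 1) =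
      φ (m + 1) - ψ (m + 1) - coneHomotopy φ ψ q m ∘ₗ d m from LinearMap.congr_fun h z
  clear z
  induction m with
  | zero =>
    refine hom_ext fun u => ?_
    simp only [LinearMap.comp_apply, coneHomotopy_succ_single, TupleChain.d_cone,
      LinearMap.sub_apply, map_sub, hφ 0, hψ 0, h0]
    simp [coneHomotopy]
  | succ m ih =>
    refine hom_ext fun u => ?_
    have := LinearMap.congr_fun ih (d (m + 1) (Finsupp.single u 1))
    simp only [LinearMap.comp_apply, LinearMap.sub_apply, d_d, map_zero, sub_zero] at this
    simp only [LinearMap.comp_apply, coneHomotopy_succ_single, TupleChain.d_cone,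
      LinearMap.sub_apply, map_sub, hφ (m + 1), hψ (m + 1), this]
    abel

theorem IsCycle.sub_eq_d_coneHomotopy {φ ψ : ∀ m, TupleChain m P →ₗ[ℤ] TupleChain m Q}
    (hφ : IsChainMap φ) (hψ : IsChainMap ψ) (h0 : φ 0 = ψ 0)
    (q : ∀ m, (Fin (m + 1) → P) → Q) {m : ℕ} {z : TupleChain m P} (hz : IsCycle z) :
    φ m z - ψ m z = d m (coneHomotopy φ ψ q m z) := by
  cases m with
  | zero => simp [coneHomotopy, h0]
  | succ m =>
    change d m z = 0 at hz
    rw [d_coneHomotopy hφ hψ h0, hz, map_zero, sub_zero]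

/-! ### Supports -/

/-- The chains all of whose tuples have the property `T`. -/
abbrev on {m : ℕ} (T : (Fin m → P) → Prop) : Submodule ℤ (TupleChain m P) :=
  Finsupp.supported ℤ ℤ {u | T u}

theorem single_mem_on {m : ℕ} {T : (Fin m → P) → Prop} {u : Fin m → P} (hu : T u) :
    Finsupp.single u (1 : ℤ) ∈ on T :=
  Finsupp.single_mem_supported ℤ 1 hu

theorem map_mem_of_on {m : ℕ} {M : Type} [AddCommGroup M] {T : (Fin m → P) → Prop}
    {f : TupleChain m P →ₗ[ℤ] M} {N : Submodule ℤ M}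
    (h : ∀ u, T u → f (Finsupp.single u 1) ∈ N) {z : TupleChain m P} (hz : z ∈ on T) :
    f z ∈ N := by
  have : on T ≤ N.comap f := by
    rw [on, Finsupp.supported_eq_span_single, Submodule.span_le]
    rintro _ ⟨u, hu, rfl⟩
    exact h u hu
  exact this hz

theorem map_eq_of_on {m : ℕ} {M : Type} [AddCommGroup M] {T : (Fin m → P) → Prop}
    {f g : TupleChain m P →ₗ[ℤ] M}
    (h : ∀ u, T u → f (Finsupp.single u 1) = g (Finsupp.single u 1))
    {z : TupleChain m P} (hz : z ∈ on T) : f z = g z := by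
  have := map_mem_of_on (f := f - g) (N := ⊥) (fun u hu => by simp [h u hu]) hz
  simpa [sub_eq_zero] using this

theorem on_mono {m : ℕ} {T T' : (Fin m → P) → Prop} (h : ∀ u, T u → T' u) : on T ≤ on T' :=
  Finsupp.supported_mono h

theorem cone_mem_on {m : ℕ} {T : (Fin m → P) → Prop} {T' : (Fin (m + 1) → P) → Prop} {p : P}
    (h : ∀ u, T u → T' (Fin.cons p u)) {z : TupleChain m P} (hz : z ∈ on T) :
    cone p z ∈ on T' :=
  map_mem_of_on (fun u hu => by rw [cone_single]; exact single_mem_on (h u hu)) hz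

theorem push_mem_on {m : ℕ} {T : (Fin m → P) → Prop} {T' : (Fin m → Q) → Prop} {f : P → Q}
    (h : ∀ u, T u → T' (f ∘ u)) {z : TupleChain m P} (hz : z ∈ on T) : push f z ∈ on T' :=
  map_mem_of_on (fun u hu => by rw [push_single]; exact single_mem_on (h u hu)) hz

theorem d_single_mem_on {m : ℕ} {T : (Fin m → P) → Prop} {u : Fin (m + 1) → P}
    (h : ∀ i : Fin (m + 1), T (u ∘ i.succAbove)) : d m (Finsupp.single u 1) ∈ on T := by
  rw [d_single]
  exact Submodule.sum_mem _ fun i _ => Submodule.smul_mem _ _ (single_mem_on (h i))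

theorem coneMap_zero_self (q : ∀ m, (Fin (m + 1) → P) → P) :
    coneMap q 0 = LinearMap.id := by
  refine hom_ext fun u => ?_
  change lift _ _ = _
  rw [lift_single, Subsingleton.elim Fin.elim0 u]; rfl

/-! ### Killing degenerate tuples -/

/-- A tuple is degenerate if two consecutive entries agree. -/
def Degenerate {m : ℕ} (u : Fin m → P) : Prop :=
  ∃ (i : ℕ) (h : i + 1 < m), u ⟨i, by omega⟩ = u ⟨i + 1, h⟩

theorem degenerate_cons {m : ℕ} {p : P} {u : Fin m → P} (hu : Degenerate u) :
    Degenerate (Fin.cons p u : Fin (m + 1) → P) := by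
  obtain ⟨i, h, e⟩ := hu
  exact ⟨i + 1, by omega, e⟩

theorem degenerate_cons_cons {m : ℕ} (p : P) (u : Fin m → P) :
    Degenerate (Fin.cons p (Fin.cons p u : Fin (m + 1) → P) : Fin (m + 2) → P) :=
  ⟨0, by omega, rfl⟩

/-- The two faces that delete one of the equal neighbours cancel; all other faces keep the
repetition. -/
theorem d_mem_on_degenerate {m : ℕ} {z : TupleChain (m + 1) P} (hz : z ∈ on Degenerate) :
    d m z ∈ on Degenerate := by
  refine map_mem_of_on (fun u hu => ?_) hz
  clear hz z
  induction m with
  | zero => obtain ⟨i, h, -⟩ := hu; omega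
  | succ m ih =>
    induction u using Fin.consCases with | _ p x => ?_
    rw [← cone_single, d_cone]
    obtain ⟨i, h, e⟩ := hu
    cases i with
    | succ i =>
      have hx : Degenerate x := ⟨i, by omega, e⟩
      exact Submodule.sub_mem _ (single_mem_on hx)
        (cone_mem_on (fun _ => degenerate_cons) (ih x hx))
    | zero =>
      induction x using Fin.consCases with | _ p' y => ?_
      obtain rfl : p = p' := e
      cases m with
      | zero =>
        rw [← cone_single, d_cone_zero, sub_self]; exact Submodule.zero_mem _
      | succ m =>
      -- With the repetition in front, the boundary of the double cone over `y` reduces to the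
      -- double cone over the boundary of `y`.
      rw [← cone_single, d_cone, map_sub, sub_sub_cancel]
      exact map_mem_of_on (T := fun _ => True) (f := cone p ∘ₗ cone p) (fun u _ => by
        simp only [LinearMap.comp_apply, cone_single]
        exact single_mem_on (degenerate_cons_cons p u)) (by simp [on])

/-- The chain map homotopic to the identity which kills degenerate tuples. -/
abbrev collapse : ∀ m, TupleChain m P →ₗ[ℤ] TupleChain m P := coneMap fun _ u => u 0

/-- `collapse` of a tuple is a cone over `collapse` of its boundary, which is again degenerate, so
induction applies. -/
theorem collapse_degenerate {m : ℕ} {z : TupleChain m P} (hz : z ∈ on Degenerate) :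
    collapse m z = 0 := by
  suffices h : ∀ u : Fin m → P, Degenerate u → collapse m (Finsupp.single u 1) = 0 from
    map_eq_of_on (g := 0) h hz
  clear hz z
  induction m with
  | zero => rintro u ⟨i, h, -⟩; omega
  | succ m ih =>
    intro u hu
    rw [collapse, coneMap_succ_single]
    have h := d_mem_on_degenerate (single_mem_on hu)
    rw [show coneMap (fun _ u => u 0) m (d m (Finsupp.single u 1)) = 0 from
      map_eq_of_on (g := 0) ih h, map_zero]

end TupleChain
end

noncomputable section

/-! ## The orientation of a tuple of points -/

/-- The homogeneous coordinates `(1, x)` of a point. -/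
def homRow {n : ℕ} (x : EuclSpace n) : Fin (n + 1) → ℝ := Fin.cons 1 fun i => x i

theorem sum_smul_homRow_eq_zero_iff {n : ℕ} {ι : Type} [Fintype ι] (w : ι → ℝ)
    (y : ι → EuclSpace n) :
    ∑ i, w i • homRow (y i) = 0 ↔ ∑ i, w i = 0 ∧ ∑ i, w i • y i = 0 := by
  constructor
  · intro h
    constructor
    · have := congrFun h 0
      simpa [homRow] using this
    · ext j
      have := congrFun h j.succ
      simpa [homRow] using this
  · rintro ⟨h1, h2⟩
    funext j
    refine Fin.cases ?_ (fun j => ?_) j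
    · simpa [homRow] using h1
    · have := congrArg (fun v : EuclSpace n => v j) h2
      simpa [homRow] using this

theorem affineIndependent_iff_sum {n : ℕ} {ι : Type} [Fintype ι] (y : ι → EuclSpace n) :
    AffineIndependent ℝ y ↔
      ∀ w : ι → ℝ, ∑ i, w i = 0 → ∑ i, w i • y i = 0 → ∀ i, w i = 0 := by
  rw [affineIndependent_iff_of_fintype]
  refine forall₂_congr fun w hw => ?_
  rw [Finset.univ.weightedVSub_eq_linear_combination hw]

/-- The determinant of the homogeneous coordinates of `n + 1` points of `n`-space. -/
def orientDet {n : ℕ} (y : Fin (n + 1) → EuclSpace n) : ℝ :=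
  Matrix.det (Matrix.of fun i => homRow (y i))

/-- A linear relation between the rows `(1, x)` is the same as an affine dependence of the points.
-/
theorem orientDet_ne_zero_iff {n : ℕ} (y : Fin (n + 1) → EuclSpace n) :
    orientDet y ≠ 0 ↔ AffineIndependent ℝ y := by
  rw [orientDet, ← isUnit_iff_ne_zero, ← Matrix.isUnit_iff_isUnit_det,
    ← Matrix.linearIndependent_rows_iff_isUnit, Fintype.linearIndependent_iff,
    affineIndependent_iff_sum]
  refine forall_congr' fun w => ?_
  rw [← and_imp, ← sum_smul_homRow_eq_zero_iff]
  rfl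

/-- Cramer's rule: coordinate `c` of the sum expands, along its first column, a determinant whose
first column repeats column `c`. The signed determinants of the faces are therefore an affine
dependence of the `n + 2` points. -/
theorem sum_orientDet_smul_homRow {n : ℕ} (y : Fin (n + 2) → EuclSpace n) :
    ∑ i : Fin (n + 2), ((-1 : ℝ) ^ (i : ℕ) * orientDet (y ∘ i.succAbove)) • homRow (y i) = 0 := by
  funext c
  have h : Matrix.det (Matrix.of fun i => (Fin.cons (homRow (y i) c) (homRow (y i)) :
      Fin (n + 2) → ℝ)) = 0 :=
    Matrix.det_zero_of_column_eq (Fin.succ_ne_zero c).symm fun i => by simp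
  rw [Matrix.det_succ_column_zero] at h
  rw [Finset.sum_apply, Pi.zero_apply, ← h]
  refine Finset.sum_congr rfl fun i _ => ?_
  simp only [Pi.smul_apply, smul_eq_mul, Matrix.of_apply, Fin.cons_zero]
  rw [mul_right_comm]
  rfl

/-- Subtracting the first row from the others leaves a determinant of difference vectors, on which
affine maps act by their linear part. -/
theorem orientDet_eq_det_sub {n : ℕ} (y : Fin (n + 1) → EuclSpace n) :
    orientDet y =
      (EuclideanSpace.basisFun (Fin n) ℝ).toBasis.det fun i => y i.succ - y 0 := by
  have h : orientDet y = Matrix.det (Matrix.of (Fin.cons (homRow (y 0))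
      fun i : Fin n => homRow (y i.succ) - homRow (y 0)) : Matrix (Fin (n + 1)) _ ℝ) := by
    refine Matrix.det_eq_of_forall_row_eq_smul_add_const (fun i => if i = 0 then 0 else 1) 0
      (by simp) fun i j => ?_
    refine Fin.cases ?_ (fun i => ?_) i <;> simp
  rw [h, Matrix.det_succ_column_zero, Fin.sum_univ_succ]
  rw [Finset.sum_eq_zero (fun i _ => by simp [homRow]), Module.Basis.det_apply,
    ← Matrix.det_transpose]
  simp only [Matrix.of_apply, Fin.cons_zero, homRow]
  simp only [Fin.val_zero, pow_zero, one_mul, add_zero]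
  congr 1

theorem orientDet_comp {n : ℕ} (g : EuclSpace n →ᵃ[ℝ] EuclSpace n)
    (y : Fin (n + 1) → EuclSpace n) :
    orientDet (g ∘ y) = LinearMap.det g.linear * orientDet y := by
  rw [orientDet_eq_det_sub, orientDet_eq_det_sub, ← Module.Basis.det_comp]
  congr 1
  funext i
  have := g.linearMap_vsub (y i.succ) (y 0)
  simpa using this.symm

/-! ## Simplices and the polytope module -/

theorem IsGeodesicSimplex.isPolytope {n : ℕ} {s : Set (EuclSpace n)}
    (hs : IsGeodesicSimplex n s) : IsPolytope n s :=
  ⟨1, fun _ => s, fun _ => hs, fun i j h => absurd (Subsingleton.elim i j) h,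
    (Set.iUnion_const s).symm⟩

theorem isPolytope_biUnion {n : ℕ} {ι : Type} {Δ : ι → Set (EuclSpace n)} {S : Finset ι}
    (h1 : ∀ i ∈ S, IsGeodesicSimplex n (Δ i))
    (h2 : ∀ i ∈ S, ∀ j ∈ S, i ≠ j → Δ i ∩ Δ j = ∅ ∨ ∃ k < n, IsGeodesicSimplex k (Δ i ∩ Δ j)) :
    IsPolytope n (⋃ i ∈ S, Δ i) := by
  refine ⟨S.card, fun k => Δ (S.equivFin.symm k), fun k => h1 _ (S.equivFin.symm k).2,
    fun i j hij => h2 _ (S.equivFin.symm i).2 _ (S.equivFin.symm j).2 fun h => hij ?_, ?_⟩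
  · exact S.equivFin.symm.injective (Subtype.ext h)
  · rw [S.equivFin.symm.surjective.iUnion_comp (fun i : S => Δ i), Set.iUnion_subtype]

theorem IsGeodesicSimplex.convex {n k : ℕ} {s : Set (EuclSpace n)}
    (hs : IsGeodesicSimplex k s) : Convex ℝ s := by
  obtain ⟨a, -, rfl⟩ := hs
  exact convex_convexHull ℝ _

theorem IsGeodesicSimplex.isClosed {n k : ℕ} {s : Set (EuclSpace n)}
    (hs : IsGeodesicSimplex k s) : IsClosed s := by
  obtain ⟨a, -, rfl⟩ := hs
  exact (Set.finite_range a).isClosed_convexHull ℝ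

theorem IsGeodesicSimplex.interior_eq_empty {n k : ℕ} {s : Set (EuclSpace n)}
    (hs : IsGeodesicSimplex k s) (hk : k < n) : interior s = ∅ := by
  obtain ⟨a, ha, rfl⟩ := hs
  by_contra h
  rw [← Ne, ← Set.nonempty_iff_ne_empty, interior_convexHull_nonempty_iff_affineSpan_eq_top,
    ha.affineSpan_eq_top_iff_card_eq_finrank_add_one] at h
  simp at h
  omega

/-- A polytope as an element of the type of polytopes. -/
def Polytope.ofSet {n : ℕ} (s : Set (EuclSpace n)) (h : IsPolytope n s) : Polytope n := ⟨s, h⟩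

/-- The underlying set of a polytope. -/
def Polytope.carrier {n : ℕ} (P : Polytope n) : Set (EuclSpace n) := P.1

/-- The class of a set in the polytope module, which is zero unless the set is a polytope. -/
def polytopeClass {n : ℕ} (s : Set (EuclSpace n)) : PolytopeModule n :=
  open Classical in
  if h : IsPolytope n s then (polytopeRelations n).mkQ (Finsupp.single (Polytope.ofSet s h) 1) else 0

theorem polytopeClass_of {n : ℕ} {s : Set (EuclSpace n)} (h : IsPolytope n s) :
    polytopeClass s = (polytopeRelations n).mkQ (Finsupp.single (Polytope.ofSet s h) 1) := by
  rw [polytopeClass, dif_pos h]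

theorem polytopeClass_union {n : ℕ} {s t : Set (EuclSpace n)} (hs : IsPolytope n s)
    (ht : IsPolytope n t) (hst : IsPolytope n (s ∪ t)) (h : interior (s ∩ t) = ∅) :
    polytopeClass (s ∪ t) = polytopeClass s + polytopeClass t := by
  rw [polytopeClass_of hs, polytopeClass_of ht, polytopeClass_of hst, ← map_add,
    ← sub_eq_zero, ← map_sub]
  refine (Submodule.Quotient.mk_eq_zero _).2 (Submodule.subset_span ?_)
  exact ⟨_, _, _, ⟨rfl, h⟩, rfl⟩

theorem polytopeClass_empty (n : ℕ) : polytopeClass (∅ : Set (EuclSpace n)) = 0 := by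
  have h : IsPolytope n (∅ : Set (EuclSpace n)) :=
    ⟨0, fun _ => ∅, fun i => i.elim0, fun i => i.elim0, by simp⟩
  have := polytopeClass_union h h (by simpa using h) (by simp)
  simpa using this

/-- The class of a polytope is the sum of the classes of the simplices into which it is cut. -/
theorem polytopeClass_biUnion {n : ℕ} {ι : Type} {Δ : ι → Set (EuclSpace n)} {S : Finset ι}
    (h1 : ∀ i ∈ S, IsGeodesicSimplex n (Δ i))
    (h2 : ∀ i ∈ S, ∀ j ∈ S, i ≠ j → Δ i ∩ Δ j = ∅ ∨ ∃ k < n, IsGeodesicSimplex k (Δ i ∩ Δ j)) :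
    polytopeClass (⋃ i ∈ S, Δ i) = ∑ i ∈ S, polytopeClass (Δ i) := by
  classical
  induction S using Finset.induction_on with
  | empty => simp [polytopeClass_empty]
  | insert a S ha ih =>
    have h1' : ∀ i ∈ S, IsGeodesicSimplex n (Δ i) := fun i hi => h1 i (by simp [hi])
    have h2' := fun i (hi : i ∈ S) j (hj : j ∈ S) => h2 i (by simp [hi]) j (by simp [hj])
    rw [Finset.sum_insert ha, ← ih h1' h2', Finset.set_biUnion_insert]
    refine polytopeClass_union (h1 a (by simp)).isPolytope (isPolytope_biUnion h1' h2') ?_ ?_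
    · rw [← Finset.set_biUnion_insert]
      exact isPolytope_biUnion h1 h2
    -- The overlap of the new simplex with the earlier ones is a finite union of closed sets without
    -- interior points.
    · have h3 : ∀ i ∈ S, IsClosed (Δ a ∩ Δ i) ∧ interior (Δ a ∩ Δ i) = ∅ := fun i hi => by
        refine ⟨(h1 a (by simp)).isClosed.inter (h1' i hi).isClosed, ?_⟩
        rcases h2 a (by simp) i (by simp [hi]) (by rintro rfl; exact ha hi) with h | ⟨k, hk, h⟩
        · rw [h, interior_empty]
        · exact h.interior_eq_empty hk
      rw [Set.inter_iUnion₂]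
      clear ih h1' h2' h1 h2 ha
      induction S using Finset.induction_on with
      | empty => simp
      | insert b S hb ih =>
        rw [Finset.set_biUnion_insert, interior_union_isClosed_of_interior_empty
          (h3 b (by simp)).1]
        · exact (h3 b (by simp)).2
        · exact ih fun i hi => h3 i (by simp [hi])

theorem mem_convexHull_range_iff {n : ℕ} {ι : Type} [Fintype ι] (y : ι → EuclSpace n)
    (x : EuclSpace n) : x ∈ convexHull ℝ (Set.range y) ↔
      ∃ w : ι → ℝ, (∀ i, 0 ≤ w i) ∧ ∑ i, w i = 1 ∧ ∑ i, w i • y i = x := by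
  classical
  constructor
  · rw [convexHull_range_eq_exists_affineCombination]
    rintro ⟨s, w, h0, h1, rfl⟩
    refine ⟨fun i => if i ∈ s then w i else 0, fun i => ?_, ?_, ?_⟩
    · dsimp only; split_ifs with h
      exacts [h0 i h, le_rfl]
    · simpa using h1
    · rw [Finset.affineCombination_eq_linear_combination _ _ _ h1]
      simp
  · rintro ⟨w, h0, h1, h⟩
    exact mem_convexHull_of_exists_fintype w y h0 h1 (fun i => Set.mem_range_self i) h

theorem mem_convexHull_face_iff {n m : ℕ} (y : Fin (m + 1) → EuclSpace n) (i : Fin (m + 1))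
    (x : EuclSpace n) : x ∈ convexHull ℝ (Set.range (y ∘ i.succAbove)) ↔
      ∃ w : Fin (m + 1) → ℝ, (∀ j, 0 ≤ w j) ∧ ∑ j, w j = 1 ∧ ∑ j, w j • y j = x ∧ w i = 0 := by
  rw [mem_convexHull_range_iff]
  constructor
  · rintro ⟨w, h0, h1, h⟩
    refine ⟨i.insertNth 0 w, fun j => ?_, ?_, ?_, by simp⟩
    · refine Fin.succAboveCases i ?_ (fun j => ?_) j <;> simp [h0]
    · rw [Fin.sum_univ_succAbove _ i]; simpa using h1
    · rw [Fin.sum_univ_succAbove _ i]; simpa using h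
  · rintro ⟨w, h0, h1, h, hi⟩
    refine ⟨w ∘ i.succAbove, fun j => h0 _, ?_, ?_⟩
    · rw [Fin.sum_univ_succAbove _ i] at h1; simpa [hi] using h1
    · rw [Fin.sum_univ_succAbove _ i] at h; simpa [hi] using h

end

/-! ### Cutting the hull of `n + 2` points in two ways: the relation between oriented simplices -/

noncomputable section

/-- A Radon-type triangulation. Subtracting multiples of the dependence `l` from barycentric weights
moves any point of the hull onto a face opposite a vertex with `0 < l i`, and two such faces meet
only in their common face. -/
theorem polytopeClass_convexHull_eq_sum {n : ℕ} (y : Fin (n + 2) → EuclSpace n)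
    (l : Fin (n + 2) → ℝ) (hl0 : ∑ i, l i = 0) (hl1 : ∑ i, l i • y i = 0)
    (hind : ∀ i, l i ≠ 0 → AffineIndependent ℝ (y ∘ i.succAbove)) (hpos : ∃ i, 0 < l i) :
    polytopeClass (convexHull ℝ (Set.range y)) =
      ∑ i with 0 < l i, polytopeClass (convexHull ℝ (Set.range (y ∘ i.succAbove))) := by
  -- Two weight vectors of one point, vanishing at `i` and at `j` respectively, differ by a multiple
  -- `s` of `l`. Nonnegativity at `i` forces `s ≤ 0`, and then nonnegativity at `j` makes the first
  -- vector vanish at `j` too.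
  have key : ∀ i j, 0 < l i → 0 < l j → ∀ x,
      x ∈ convexHull ℝ (Set.range (y ∘ i.succAbove)) →
      x ∈ convexHull ℝ (Set.range (y ∘ j.succAbove)) →
      ∃ w : Fin (n + 2) → ℝ, (∀ j, 0 ≤ w j) ∧ ∑ j, w j = 1 ∧ ∑ j, w j • y j = x ∧
        w i = 0 ∧ w j = 0 := by
    intro i j hi hj x hxi hxj
    rw [mem_convexHull_face_iff] at hxi hxj
    obtain ⟨w, hw0, hw1, hwx, hwi⟩ := hxi
    obtain ⟨v, hv0, hv1, hvx, hvj⟩ := hxj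
    refine ⟨w, hw0, hw1, hwx, hwi, ?_⟩
    -- Removing the multiple of `l` that clears entry `i` leaves a dependence among independent
    -- points.
    obtain ⟨s, hs⟩ : ∃ s : ℝ, ∀ k, w k - v k - s * l k = 0 := by
      refine ⟨(w i - v i) / l i, ?_⟩
      set u : Fin (n + 2) → ℝ := fun k => w k - v k - (w i - v i) / l i * l k
      have hui : u i = 0 := by simp only [u]; field_simp; ring
      have hu0 : ∑ k, u k = 0 := by
        simp only [u, Finset.sum_sub_distrib, ← Finset.mul_sum, hw1, hv1, hl0]; simp
      have hu1 : ∑ k, u k • y k = 0 := by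
        simp only [u, sub_smul, Finset.sum_sub_distrib, mul_smul, ← Finset.smul_sum, hwx, hvx,
          hl1]
        simp
      have := (affineIndependent_iff_sum _).1 (hind i hi.ne') (u ∘ i.succAbove)
        (by rw [Fin.sum_univ_succAbove _ i] at hu0; simpa [hui] using hu0)
        (by rw [Fin.sum_univ_succAbove _ i] at hu1; simpa [hui] using hu1)
      intro k
      exact Fin.succAboveCases i hui (fun k => this k) k
    have h1 := hs i
    have h2 := hs j
    rw [hwi] at h1
    rw [hvj] at h2
    have h3 : s ≤ 0 := by
      by_contra h
      have := mul_pos (not_le.1 h) hi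
      linarith [hv0 i]
    have h5 : s * l j ≤ 0 := mul_nonpos_of_nonpos_of_nonneg h3 hj.le
    linarith [hw0 j]
  have hU : convexHull ℝ (Set.range y) =
      ⋃ i ∈ Finset.univ.filter fun i => 0 < l i,
        convexHull ℝ (Set.range (y ∘ i.succAbove)) := by
    apply Set.Subset.antisymm
    · intro x hx
      obtain ⟨w, hw0, hw1, hwx⟩ := (mem_convexHull_range_iff y x).1 hx
      -- The minimal ratio is the largest multiple of `l` that can be subtracted while all weights
      -- stay nonnegative.
      obtain ⟨i, hi, hmin⟩ := (Finset.univ.filter fun i => 0 < l i).exists_min_image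
        (fun i => w i / l i) (by obtain ⟨i, hi⟩ := hpos; exact ⟨i, by simpa using hi⟩)
      have hi' : 0 < l i := by simpa using hi
      refine Set.mem_iUnion₂.2 ⟨i, hi, (mem_convexHull_face_iff y i x).2
        ⟨fun k => w k - w i / l i * l k, fun k => ?_, ?_, ?_, ?_⟩⟩
      · rcases lt_or_ge 0 (l k) with hk | hk
        · have := hmin k (by simpa using hk)
          rw [div_le_div_iff₀ hi' hk] at this
          rw [sub_nonneg, div_mul_eq_mul_div, div_le_iff₀ hi']
          exact this
        · have := mul_nonneg_of_nonpos_of_nonpos (neg_nonpos.2 (div_nonneg (hw0 i) hi'.le)) hk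
          have := hw0 k
          linarith
      · simp only [Finset.sum_sub_distrib, ← Finset.mul_sum, hw1, hl0]; simp
      · simp only [sub_smul, Finset.sum_sub_distrib, mul_smul, ← Finset.smul_sum, hwx, hl1]
        simp
      · dsimp only; field_simp; ring
    · refine Set.iUnion₂_subset fun i _ => convexHull_mono ?_
      exact Set.range_comp_subset_range _ _
  rw [hU]
  refine polytopeClass_biUnion (fun i hi => ⟨_, hind i (by simpa using (by simpa using hi :
    0 < l i).ne'), rfl⟩) fun i hi j hj hij => Or.inr ?_
  have hi : 0 < l i := by simpa using hi
  have hj : 0 < l j := by simpa using hj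
  obtain ⟨j', rfl⟩ := Fin.exists_succAbove_eq hij.symm
  cases n with
  | zero =>
    -- For `n = 0` there are two coefficients with sum zero, so they cannot both be positive.
    rw [Fin.sum_univ_succAbove _ i] at hl0
    have : j' = 0 := Fin.fin_one_eq_zero j'
    subst this
    simp at hl0
    linarith
  | succ n =>
    refine ⟨n, Nat.lt_succ_self n, (y ∘ i.succAbove) ∘ j'.succAbove,
      (hind i hi.ne').comp_embedding j'.succAboveEmb, ?_⟩
    apply Set.Subset.antisymm
    · rintro x ⟨hx, hx'⟩
      obtain ⟨w, hw0, hw1, hwx, hwi, hwj⟩ := key _ _ hi hj x hx hx'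
      refine (mem_convexHull_face_iff _ j' x).2 ⟨w ∘ i.succAbove, fun _ => hw0 _, ?_, ?_, hwj⟩
      · rw [Fin.sum_univ_succAbove _ i] at hw1; simpa [hwi] using hw1
      · rw [Fin.sum_univ_succAbove _ i] at hwx; simpa [hwi] using hwx
    · refine Set.subset_inter (convexHull_mono (Set.range_comp_subset_range _ _))
        (convexHull_mono ?_)
      rintro _ ⟨k, rfl⟩
      obtain ⟨k', hk'⟩ := Fin.exists_succAbove_eq (y := i.succAbove j')
        (x := i.succAbove (j'.succAbove k)) (fun h =>
          Fin.succAbove_ne j' k (Fin.succAbove_right_injective h))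
      exact ⟨k', congrArg y hk'⟩

/-- The oriented class of the simplex spanned by a tuple of points, zero if it is degenerate. -/
def simplexClass {n : ℕ} (y : Fin (n + 1) → EuclSpace n) : PolytopeModule n :=
  ((SignType.sign (orientDet y) : SignType) : ℤ) •
    polytopeClass (convexHull ℝ (Set.range y))

theorem simplexClass_of_not_affineIndependent {n : ℕ} {y : Fin (n + 1) → EuclSpace n}
    (h : ¬ AffineIndependent ℝ y) : simplexClass y = 0 := by
  have : orientDet y = 0 := by
    by_contra h'
    exact h ((orientDet_ne_zero_iff y).1 h')
  simp [simplexClass, this]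

/-- The coefficients of Cramer's dependence carry the signs of the terms. The faces with positive
coefficient and those with negative coefficient triangulate the same hull, so their contributions
cancel. -/
theorem sum_simplexClass_eq_zero {n : ℕ} (y : Fin (n + 2) → EuclSpace n) :
    ∑ i : Fin (n + 2), (-1 : ℤ) ^ (i : ℕ) • simplexClass (y ∘ i.succAbove) = 0 := by
  set l : Fin (n + 2) → ℝ := fun i => (-1) ^ (i : ℕ) * orientDet (y ∘ i.succAbove) with hl
  obtain ⟨hl0, hl1⟩ := (sum_smul_homRow_eq_zero_iff l y).1 (sum_orientDet_smul_homRow y)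
  have hind : ∀ i, l i ≠ 0 → AffineIndependent ℝ (y ∘ i.succAbove) := fun i hi =>
    (orientDet_ne_zero_iff _).1 (right_ne_zero_of_mul hi)
  set Q : Fin (n + 2) → PolytopeModule n := fun i =>
    polytopeClass (convexHull ℝ (Set.range (y ∘ i.succAbove)))
  have hterm : ∀ i : Fin (n + 2), (-1 : ℤ) ^ (i : ℕ) • simplexClass (y ∘ i.succAbove) =
      (if 0 < l i then Q i else 0) - if 0 < -l i then Q i else 0 := by
    intro i
    have hs : (-1 : ℤ) ^ (i : ℕ) * ((SignType.sign (orientDet (y ∘ i.succAbove)) : SignType) : ℤ)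
        = ((SignType.sign (l i) : SignType) : ℤ) := by
      rw [hl]
      simp only [sign_mul, sign_pow, SignType.coe_mul, SignType.coe_pow]
      simp
    rw [simplexClass, smul_smul, hs]
    rcases lt_trichotomy (l i) 0 with h | h | h
    · simp [h, h.not_gt, Q]
    · simp [h]
    · simp [h, h.not_gt, Q]
  rw [Finset.sum_congr rfl fun i _ => hterm i, Finset.sum_sub_distrib, ← Finset.sum_filter,
    ← Finset.sum_filter]
  by_cases hz : ∀ i, l i = 0
  · simp [hz]
  push Not at hz
  obtain ⟨i, hi⟩ := hz
  have hpos : ∃ i, 0 < l i := by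
    by_contra! h
    exact hi ((Finset.sum_eq_zero_iff_of_nonpos fun i _ => h i).1 hl0 i (Finset.mem_univ i))
  have hneg : ∃ i, 0 < -l i := by
    by_contra! h
    exact hi ((Finset.sum_eq_zero_iff_of_nonneg fun i _ => by linarith [h i]).1 hl0 i
      (Finset.mem_univ i))
  rw [← polytopeClass_convexHull_eq_sum y l hl0 hl1 hind hpos,
    ← polytopeClass_convexHull_eq_sum y (fun i => -l i) (by simp [hl0]) (by simp [hl1])
      (fun i hi => hind i (neg_ne_zero.1 hi)) hneg, sub_self]

/-! ### Isometries acting on simplex classes, and generation by simplices -/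

theorem polytopeRep_mkQ_single {n : ℕ} (g : EuclIsom n) (P : Polytope n) :
    polytopeRep n g ((polytopeRelations n).mkQ (Finsupp.single P 1)) =
      (polytopeRelations n).mkQ (Finsupp.single (P.map g) 1) := by
  change (polytopeRelations n).mapQ (polytopeRelations n)
    (Finsupp.lmapDomain ℤ ℤ (Polytope.map g)) (polytopeRelations_le g) _ = _
  rw [Submodule.mkQ_apply, Submodule.mapQ_apply, Finsupp.lmapDomain_apply,
    Finsupp.mapDomain_single]
  rfl

/-- The image of a simplex under an isometry, with its orientation. -/
theorem simplexClass_comp {n : ℕ} (g : EuclIsom n) (y : Fin (n + 1) → EuclSpace n) :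
    simplexClass (g ∘ y) = isomSign n g • polytopeRep n g (simplexClass y) := by
  by_cases hy : AffineIndependent ℝ y
  · have hP : IsPolytope n (convexHull ℝ (Set.range y)) :=
      IsGeodesicSimplex.isPolytope ⟨y, hy, rfl⟩
    have hr : convexHull ℝ (Set.range (g ∘ y)) = g '' convexHull ℝ (Set.range y) := by
      rw [Set.range_comp]
      exact ((isomAffine g).image_convexHull _).symm
    have hd : orientDet (g ∘ y) = LinearMap.det (isomAffine g).linear * orientDet y :=
      orientDet_comp (isomAffine g) y
    rw [simplexClass, simplexClass, hr, polytopeClass_of hP, polytopeClass_of (hP.image g), hd,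
      sign_mul, SignType.coe_mul, mul_smul, map_zsmul]
    rw [polytopeRep_mkQ_single]; rfl
  · rw [simplexClass_of_not_affineIndependent hy, map_zero, smul_zero]
    refine simplexClass_of_not_affineIndependent fun h => hy ?_
    exact (AffineMap.affineIndependent_iff (f := isomAffine g) g.injective).1 h

/-- The polytope module is generated by the classes of simplices. -/
theorem polytopeModule_induction {n : ℕ} {N : Submodule ℤ (PolytopeModule n)}
    (h : ∀ y : Fin (n + 1) → EuclSpace n, AffineIndependent ℝ y →
      polytopeClass (convexHull ℝ (Set.range y)) ∈ N) : N = ⊤ := by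
  rw [eq_top_iff]
  rintro x -
  obtain ⟨x, rfl⟩ := (polytopeRelations n).mkQ_surjective x
  induction x using Finsupp.induction_linear with
  | zero => simp
  | add x y hx hy => rw [map_add]; exact N.add_mem hx hy
  | single P c =>
    rw [← mul_one c, ← smul_eq_mul, ← Finsupp.smul_single, map_smul]
    refine N.smul_mem _ ?_
    obtain ⟨P, hP, rfl⟩ : ∃ s h, P = Polytope.ofSet s h := ⟨P.1, P.2, rfl⟩
    rw [← polytopeClass_of hP]
    obtain ⟨m, Δ, h1, h2, rfl⟩ := hP
    have : (⋃ i, Δ i) = ⋃ i ∈ Finset.univ, Δ i := by simp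
    rw [this, polytopeClass_biUnion (fun i _ => h1 i) (fun i _ j _ => h2 i j)]
    refine N.sum_mem fun i _ => ?_
    obtain ⟨a, ha, e⟩ := h1 i
    rw [e]
    exact h a ha

end

noncomputable section

/-! ## Chains of flags -/

open TupleChain

/-- All affine subspaces of Euclidean space. -/
abbrev Flat (n : ℕ) : Type := AffineSubspace ℝ (EuclSpace n)

/-- Descending tuples of proper flats. -/
def IsFlag {n m : ℕ} (u : Fin m → Flat n) : Prop :=
  Antitone u ∧ ∀ i, u i ≠ ⊥ ∧ u i ≠ ⊤

/-- Descending tuples of nonempty flats contained in `V`. -/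
def FlagIn {n m : ℕ} (V : Flat n) (u : Fin m → Flat n) : Prop :=
  Antitone u ∧ ∀ i, u i ≠ ⊥ ∧ u i ≤ V

/-- Tuples of points of `V`. -/
def PointsIn {n m : ℕ} (V : Flat n) (y : Fin m → EuclSpace n) : Prop := ∀ i, y i ∈ V

theorem FlagIn.isFlag {n m : ℕ} {V : Flat n} {u : Fin m → Flat n} (hu : FlagIn V u)
    (hV : V ≠ ⊤) : IsFlag u :=
  ⟨hu.1, fun i => ⟨(hu.2 i).1, fun h => hV (top_le_iff.1 (h ▸ (hu.2 i).2))⟩⟩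

theorem FlagIn.cons {n m : ℕ} {U V : Flat n} {u : Fin m → Flat n} (hu : FlagIn U u)
    (hU : U ≠ ⊥) (h : U ≤ V) : FlagIn V (Fin.cons U u : Fin (m + 1) → Flat n) := by
  refine ⟨fun i j hij => ?_, fun i => ?_⟩
  · induction i using Fin.cases with
    | zero =>
      induction j using Fin.cases with
      | zero => exact le_rfl
      | succ j => exact (hu.2 j).2
    | succ i =>
      induction j using Fin.cases with
      | zero => simp at hij
      | succ _ => exact hu.1 (by simpa using hij)
  · induction i using Fin.cases with
    | zero => exact ⟨hU, h⟩
    | succ i => exact ⟨(hu.2 i).1, (hu.2 i).2.trans h⟩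

theorem FlagIn.face {n m : ℕ} {V : Flat n} {u : Fin (m + 1) → Flat n} (hu : FlagIn V u)
    (i : Fin (m + 1)) : FlagIn V (u ∘ i.succAbove) :=
  ⟨hu.1.comp_monotone i.strictMono_succAbove.monotone, fun _ => hu.2 _⟩

theorem FlagIn.head {n m : ℕ} {V : Flat n} {u : Fin (m + 1) → Flat n} (hu : FlagIn V u) :
    FlagIn (u 0) u :=
  ⟨hu.1, fun i => ⟨(hu.2 i).1, hu.1 (Fin.zero_le i)⟩⟩

theorem IsFlag.flagIn_head {n m : ℕ} {u : Fin (m + 1) → Flat n} (hu : IsFlag u) :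
    FlagIn (u 0) u :=
  ⟨hu.1, fun i => ⟨(hu.2 i).1, hu.1 (Fin.zero_le i)⟩⟩

theorem PointsIn.cons {n m : ℕ} {V : Flat n} {y : Fin m → EuclSpace n} (hy : PointsIn V y)
    {p : EuclSpace n} (hp : p ∈ V) : PointsIn V (Fin.cons p y : Fin (m + 1) → EuclSpace n) :=
  fun i => Fin.cases hp hy i

/-- A choice of a point in every nonempty flat. -/
def IsSection {n : ℕ} (a : Flat n → EuclSpace n) : Prop := ∀ U : Flat n, U ≠ ⊥ → a U ∈ U

theorem FlagIn.pointsIn {n m : ℕ} {V : Flat n} {u : Fin m → Flat n} (hu : FlagIn V u)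
    {a : Flat n → EuclSpace n} (ha : IsSection a) : PointsIn V (a ∘ u) :=
  fun i => (hu.2 i).2 (ha _ (hu.2 i).1)

theorem exists_isSection (n : ℕ) : ∃ a : Flat n → EuclSpace n, IsSection a := by
  classical
  refine ⟨fun U => if h : U ≠ ⊥ then ((AffineSubspace.nonempty_iff_ne_bot U).2 h).some else 0,
    fun U hU => ?_⟩
  dsimp only
  rw [dif_pos hU]
  exact Set.Nonempty.some_mem _

/-! ### Subdivision -/

/-- The chain map from tuples of points to tuples of flats given by barycentric subdivision. -/
abbrev subdivide {n : ℕ} (m : ℕ) : TupleChain m (EuclSpace n) →ₗ[ℤ] TupleChain m (Flat n) :=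
  coneMap (fun _ y => affineSpan ℝ (Set.range y)) m

/-- Each apex is the span of the current tuple and contains the spans of all faces, so prepending it
keeps the flag descending. -/
theorem subdivide_single_mem {n m : ℕ} {V : Flat n} {y : Fin m → EuclSpace n}
    (hy : PointsIn V y) : subdivide m (Finsupp.single y 1) ∈ on (FlagIn V) := by
  induction m generalizing V with
  | zero =>
    change lift _ _ ∈ _
    rw [lift_single]
    exact single_mem_on ⟨fun i => i.elim0, fun i => i.elim0⟩
  | succ m ih =>
    rw [subdivide, coneMap_succ_single]
    refine cone_mem_on (T := FlagIn (affineSpan ℝ (Set.range y))) (fun u hu => hu.cons ?_ ?_) ?_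
    · rw [← AffineSubspace.nonempty_iff_ne_bot]
      exact ⟨y 0, subset_affineSpan ℝ _ ⟨0, rfl⟩⟩
    · rw [affineSpan_le]
      rintro _ ⟨i, rfl⟩
      exact hy i
    · refine map_mem_of_on (T := PointsIn (affineSpan ℝ (Set.range y))) (fun _ => ih)
        (d_single_mem_on fun i j => subset_affineSpan ℝ _ ⟨_, rfl⟩)

theorem affineSpan_range_ne_top {n m : ℕ} (h : m ≤ n) (y : Fin m → EuclSpace n) :
    affineSpan ℝ (Set.range y) ≠ ⊤ := by
  intro h'
  cases m with
  | zero =>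
    rw [Set.range_eq_empty, AffineSubspace.span_empty] at h'
    exact AffineSubspace.bot_ne_top ℝ _ _ h'
  | succ m =>
    have h1 := finrank_vectorSpan_range_le ℝ y (n := m) (by simp)
    rw [← direction_affineSpan, h', AffineSubspace.direction_top, finrank_top] at h1
    simp at h1
    omega

/-- The bound `m ≤ n` is what keeps the whole space out of the subdivision, and so marks where
vanishing of homology stops. -/
theorem subdivide_mem_on_isFlag {n m : ℕ} (h : m ≤ n) (z : TupleChain m (EuclSpace n)) :
    subdivide m z ∈ on IsFlag := by
  refine map_mem_of_on (T := fun _ => True) (fun y _ => ?_) (by simp [on])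
  refine on_mono (fun u hu => hu.isFlag (affineSpan_range_ne_top h y))
    (subdivide_single_mem (V := affineSpan ℝ (Set.range y)) fun i => ?_)
  exact subset_affineSpan ℝ _ ⟨i, rfl⟩

/-! ### Supports of homotopies -/

/-- Changing the section moves a flag only inside its largest member. In top degree the homotopy
thus consists of simplices in a proper flat, whose classes vanish. -/
theorem coneHomotopy_push_mem {n m : ℕ} {a b : Flat n → EuclSpace n} (ha : IsSection a)
    (hb : IsSection b) {V : Flat n} {u : Fin m → Flat n} (hu : FlagIn V u) :
    coneHomotopy (fun _ => push a) (fun _ => push b) (fun _ u => a (u 0)) m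
      (Finsupp.single u 1) ∈ on (PointsIn V) := by
  induction m with
  | zero => exact Submodule.zero_mem _
  | succ m ih =>
    rw [coneHomotopy_succ_single, push_single, push_single]
    refine cone_mem_on (T := PointsIn V) (fun y hy => hy.cons (hu.pointsIn ha 0)) ?_
    refine Submodule.sub_mem _ (Submodule.sub_mem _ (single_mem_on (hu.pointsIn ha))
      (single_mem_on (hu.pointsIn hb))) ?_
    exact map_mem_of_on (T := FlagIn V) (fun _ => ih) (d_single_mem_on hu.face)

theorem coneHomotopy_points_mem {n m : ℕ} {a : Flat n → EuclSpace n} (ha : IsSection a)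
    {V : Flat n} {y : Fin m → EuclSpace n} (hy : PointsIn V y) :
    coneHomotopy (fun m => push a ∘ₗ subdivide m) (fun _ => LinearMap.id) (fun _ y => y 0) m
      (Finsupp.single y 1) ∈ on (PointsIn V) := by
  induction m with
  | zero => exact Submodule.zero_mem _
  | succ m ih =>
    rw [coneHomotopy_succ_single]
    refine cone_mem_on (T := PointsIn V) (fun x hx => hx.cons (hy 0)) ?_
    refine Submodule.sub_mem _ (Submodule.sub_mem _ ?_ (single_mem_on hy)) ?_
    · exact push_mem_on (fun u hu => hu.pointsIn ha) (subdivide_single_mem hy)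
    · exact map_mem_of_on (T := PointsIn V) (fun _ => ih)
        (d_single_mem_on fun i j => hy _)

/-- The induction passes from `V` to the head `u 0`: everything built from the faces lies below `u
0`, so `u 0` may be put in front. -/
theorem coneHomotopy_flags_mem {n : ℕ} {φ : ∀ m, TupleChain m (Flat n) →ₗ[ℤ] TupleChain m (Flat n)}
    (hφ : ∀ m (V : Flat n) (u : Fin m → Flat n), FlagIn V u →
      φ m (Finsupp.single u 1) ∈ on (FlagIn V))
    {m : ℕ} {V : Flat n} {u : Fin m → Flat n} (hu : FlagIn V u) :
    coneHomotopy (fun _ => LinearMap.id) φ (fun _ u => u 0) m (Finsupp.single u 1) ∈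
      on (FlagIn V) := by
  induction m generalizing V with
  | zero => exact Submodule.zero_mem _
  | succ m ih =>
    rw [coneHomotopy_succ_single]
    refine cone_mem_on (T := FlagIn (u 0)) (fun v hv => hv.cons (hu.2 0).1 (hu.2 0).2) ?_
    refine Submodule.sub_mem _ (Submodule.sub_mem _ (single_mem_on hu.head)
      (hφ _ _ _ hu.head)) ?_
    exact map_mem_of_on (T := FlagIn (u 0)) (fun _ => ih) (d_single_mem_on hu.head.face)

/-- A cycle of flags which is killed by a chain map preserving flags is a boundary. -/
theorem exists_d_eq_of_isCycle {n : ℕ} {φ : ∀ m, TupleChain m (Flat n) →ₗ[ℤ] TupleChain m (Flat n)}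
    (hφ : IsChainMap φ) (hφ0 : φ 0 = LinearMap.id)
    (hφV : ∀ m (V : Flat n) (u : Fin m → Flat n), FlagIn V u →
      φ m (Finsupp.single u 1) ∈ on (FlagIn V))
    {m : ℕ} {z : TupleChain m (Flat n)} (hz : IsCycle z) (hzF : z ∈ on IsFlag) :
    ∃ w ∈ on IsFlag, z - φ m z = d m w := by
  refine ⟨_, ?_, IsCycle.sub_eq_d_coneHomotopy (φ := fun _ => LinearMap.id) (fun _ _ => rfl) hφ
    hφ0.symm (fun _ u => u 0) hz⟩
  refine map_mem_of_on (fun u hu => ?_) hzF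
  cases m with
  | zero => exact Submodule.zero_mem _
  | succ m =>
    exact on_mono (fun v hv => hv.isFlag (hu.2 0).2) (coneHomotopy_flags_mem hφV hu.flagIn_head)

theorem collapse_single_mem {n m : ℕ} {V : Flat n} {u : Fin m → Flat n} (hu : FlagIn V u) :
    collapse m (Finsupp.single u 1) ∈ on (FlagIn V) := by
  induction m generalizing V with
  | zero => rw [collapse, coneMap_zero_self]; exact single_mem_on hu
  | succ m ih =>
    rw [collapse, coneMap_succ_single]
    refine cone_mem_on (T := FlagIn (u 0)) (fun v hv => hv.cons (hu.2 0).1 (hu.2 0).2) ?_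
    exact map_mem_of_on (T := FlagIn (u 0)) (fun _ => ih) (d_single_mem_on hu.head.face)

/-- A cycle of degenerate flags is a boundary. -/
theorem exists_d_eq_of_degenerate {n m : ℕ} {z : TupleChain m (Flat n)} (hz : IsCycle z)
    (hzF : z ∈ on IsFlag) (hzD : z ∈ on Degenerate) : ∃ w ∈ on IsFlag, z = d m w := by
  have := exists_d_eq_of_isCycle (isChainMap_coneMap _) (coneMap_zero_self _)
    (fun m V u hu => collapse_single_mem hu) hz hzF
  rwa [collapse_degenerate hzD, sub_zero] at this

/-- Cycles of flags of small length are boundaries. -/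
theorem exists_d_eq_of_lt {n m : ℕ} (hm : m < n) {z : TupleChain m (Flat n)} (hz : IsCycle z)
    (hzF : z ∈ on IsFlag) : ∃ w ∈ on IsFlag, z = d m w := by
  obtain ⟨a, ha⟩ := exists_isSection n
  -- Choosing points and subdividing stays below the head of a flag, hence is homotopic to the
  -- identity through flags.
  have hc : IsChainMap fun m => subdivide m ∘ₗ push (m := m) a := fun m z => by
    simp only [LinearMap.comp_apply]
    rw [isChainMap_coneMap, isChainMap_push]
  obtain ⟨w, hw, e⟩ := exists_d_eq_of_isCycle hc (by
      refine hom_ext fun u => ?_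
      simp only [LinearMap.comp_apply, push_single]
      change lift _ _ = _
      rw [lift_single, Subsingleton.elim Fin.elim0 u]; rfl)
    (fun m V u hu => by
      simp only [LinearMap.comp_apply, push_single]
      exact subdivide_single_mem (hu.pointsIn ha)) hz hzF
  -- The pushed cycle bounds the cone with apex `0`. That cone has tuples of length `m + 1 ≤ n`, so
  -- its subdivision uses proper flats only.
  refine ⟨w + subdivide (m + 1) (cone 0 (push a z)),
    Submodule.add_mem _ hw (subdivide_mem_on_isFlag hm _), ?_⟩
  rw [map_add, ← e, isChainMap_coneMap, IsCycle.d_cone (hz.map (isChainMap_push a))]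
  simp

/-! ### Evaluation in the polytope module -/

/-- The oriented class of a chain of tuples of points. -/
abbrev evalSimplex {n : ℕ} : TupleChain (n + 1) (EuclSpace n) →ₗ[ℤ] PolytopeModule n :=
  lift simplexClass

theorem evalSimplex_d {n : ℕ} (z : TupleChain (n + 2) (EuclSpace n)) :
    evalSimplex (d (n + 1) z) = 0 := by
  suffices h : evalSimplex ∘ₗ d (n + 1) = (0 : TupleChain (n + 2) (EuclSpace n) →ₗ[ℤ] _) from
    LinearMap.congr_fun h z
  refine hom_ext fun u => ?_
  simp only [LinearMap.comp_apply, d_single, map_sum, map_smul, lift_single]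
  exact sum_simplexClass_eq_zero u

theorem simplexClass_eq_zero_of_pointsIn {n : ℕ} {V : Flat n} (hV : V ≠ ⊤)
    {y : Fin (n + 1) → EuclSpace n} (hy : PointsIn V y) : simplexClass y = 0 := by
  refine simplexClass_of_not_affineIndependent fun h => hV ?_
  have := h.affineSpan_eq_top_iff_card_eq_finrank_add_one.2 (by simp)
  rw [← top_le_iff, ← this, affineSpan_le]
  rintro _ ⟨i, rfl⟩
  exact hy i

/-- The difference of the two chains is the boundary of `cone p z`, on which `evalSimplex` vanishes.
-/
theorem evalSimplex_cone_d {n : ℕ} (p : EuclSpace n) (z : TupleChain (n + 1) (EuclSpace n)) :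
    evalSimplex (cone p (d n z)) = evalSimplex z := by
  have := evalSimplex_d (cone p z)
  rw [d_cone, map_sub, sub_eq_zero] at this
  exact this.symm

theorem evalSimplex_cone_eq {n : ℕ} {z : TupleChain n (EuclSpace n)} (hz : IsCycle z)
    (p q : EuclSpace n) : evalSimplex (cone p z) = evalSimplex (cone q z) := by
  have := evalSimplex_cone_d p (cone q z)
  rwa [hz.d_cone] at this

/-- The map sending a flag `U₀ ⊇ ⋯ ⊇ U_{n-1}` to the class of the simplex with vertices
`p, a(U₀), …, a(U_{n-1})`. -/
def evalFlag {n : ℕ} (p : EuclSpace n) (a : Flat n → EuclSpace n) :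
    TupleChain n (Flat n) →ₗ[ℤ] PolytopeModule n :=
  evalSimplex ∘ₗ cone p ∘ₗ push a

theorem evalFlag_apply {n : ℕ} (p : EuclSpace n) (a : Flat n → EuclSpace n)
    (z : TupleChain n (Flat n)) : evalFlag p a z = evalSimplex (cone p (push a z)) := rfl

theorem evalFlag_single {n : ℕ} (p : EuclSpace n) (a : Flat n → EuclSpace n)
    (u : Fin n → Flat n) :
    evalFlag p a (Finsupp.single u 1) = simplexClass (Fin.cons p (a ∘ u)) := by
  rw [evalFlag_apply, push_single, cone_single, lift_single]

/-- Without the cone, the simplex of a flag of length `n + 1` has all its vertices in the proper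
flat at its head. -/
theorem evalFlag_d {n : ℕ} (p : EuclSpace n) {a : Flat n → EuclSpace n} (ha : IsSection a)
    {z : TupleChain (n + 1) (Flat n)} (hz : z ∈ on IsFlag) : evalFlag p a (d n z) = 0 := by
  rw [evalFlag_apply, ← isChainMap_push, evalSimplex_cone_d]
  refine map_eq_of_on (f := evalSimplex ∘ₗ push a) (g := 0) (fun u hu => ?_) hz
  rw [LinearMap.comp_apply, push_single, lift_single]
  exact simplexClass_eq_zero_of_pointsIn (hu.2 0).2 (hu.flagIn_head.pointsIn ha)

/-- The class of a cycle of flags does not depend on the chosen points. -/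
theorem evalFlag_eq {n : ℕ} (p q : EuclSpace n) {a b : Flat n → EuclSpace n}
    (ha : IsSection a) (hb : IsSection b) {z : TupleChain n (Flat n)} (hz : IsCycle z)
    (hzF : z ∈ on IsFlag) : evalFlag p a z = evalFlag q b z := by
  rw [evalFlag_apply, evalFlag_apply,
    evalSimplex_cone_eq (hz.map (isChainMap_push b)) q p, ← sub_eq_zero, ← map_sub, ← map_sub]
  -- The two pushed cycles differ by the boundary of the homotopy; coning this boundary off
  -- evaluates like the homotopy itself, whose simplices are flat.
  have := IsCycle.sub_eq_d_coneHomotopy (isChainMap_push a) (isChainMap_push b)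
    (hom_ext fun u => by rw [push_single, push_single, Subsingleton.elim (a ∘ u)])
    (fun _ u => a (u 0)) hz
  rw [this, evalSimplex_cone_d]
  refine map_eq_of_on (f := evalSimplex ∘ₗ coneHomotopy _ _ _ n) (g := 0) (fun u hu => ?_) hzF
  cases n with
  | zero => exact map_zero evalSimplex
  | succ n =>
    refine map_eq_of_on (f := evalSimplex) (g := 0) (fun y hy => ?_)
      (coneHomotopy_push_mem ha hb hu.flagIn_head)
    rw [lift_single]
    exact simplexClass_eq_zero_of_pointsIn (hu.2 0).2 hy

/-- The class of a simplex is attained at the subdivision of its boundary. -/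
theorem exists_evalFlag_eq_simplexClass {n : ℕ} (p : EuclSpace n) {a : Flat n → EuclSpace n}
    (ha : IsSection a) (y : Fin (n + 1) → EuclSpace n) :
    ∃ z ∈ on IsFlag, IsCycle z ∧ evalFlag p a z = simplexClass y := by
  have hc : IsChainMap fun m => push (m := m) a ∘ₗ subdivide m := fun m z => by
    simp only [LinearMap.comp_apply]
    rw [isChainMap_push, isChainMap_coneMap]
  have hy := isCycle_d (Finsupp.single y (1 : ℤ))
  refine ⟨subdivide n (d n (Finsupp.single y 1)), subdivide_mem_on_isFlag le_rfl _,
    hy.map (isChainMap_coneMap _), ?_⟩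
  have := IsCycle.sub_eq_d_coneHomotopy hc (ψ := fun _ => LinearMap.id) (fun _ _ => rfl)
    (hom_ext fun u => by
      simp only [LinearMap.comp_apply]
      change push a (lift _ _) = _
      rw [lift_single, push_single]
      exact congrArg (fun v => Finsupp.single v 1) (Subsingleton.elim _ _))
    (fun _ y => y 0) hy
  simp only [LinearMap.comp_apply, LinearMap.id_apply] at this
  rw [evalFlag_apply, sub_eq_iff_eq_add.1 this, map_add, map_add, evalSimplex_cone_d,
    evalSimplex_cone_d, lift_single, add_eq_right]
  -- What remains is the homotopy on the faces of `y`. A face has `n` points, and the homotopy stays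
  -- in their span, a proper flat.
  refine map_eq_of_on (f := evalSimplex ∘ₗ coneHomotopy _ _ _ n) (g := 0)
    (T := fun _ => True) (fun x _ => ?_) (by simp [on])
  refine map_eq_of_on (f := evalSimplex) (g := 0) (fun y hy => ?_) (coneHomotopy_points_mem ha
    (V := affineSpan ℝ (Set.range x)) fun i => subset_affineSpan ℝ _ ⟨i, rfl⟩)
  rw [lift_single]
  exact simplexClass_eq_zero_of_pointsIn (affineSpan_range_ne_top le_rfl x) hy

/-- The class of a cycle of flags is equivariant up to the sign of isometries. -/
theorem evalFlag_push {n : ℕ} (g : EuclIsom n) (p : EuclSpace n) {a : Flat n → EuclSpace n}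
    (ha : IsSection a) {z : TupleChain n (Flat n)} (hz : IsCycle z) (hzF : z ∈ on IsFlag) :
    evalFlag p a (push (AffineSubspace.map (isomAffine g)) z) =
      isomSign n g • polytopeRep n g (evalFlag p a z) := by
  have hmap : ∀ (h h' : EuclIsom n) (U : Flat n), h * h' = 1 →
      (U.map (isomAffine h')).map (isomAffine h) = U := fun h h' U e => by
    rw [AffineSubspace.map_map, ← isomAffine_mul, e, isomAffine_one, AffineSubspace.map_id]
  -- The section `a` conjugated by `g`. Independence of choices allows replacing `p, a` by `g p, b`,
  -- after which equivariance holds tuple by tuple.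
  set b : Flat n → EuclSpace n := fun U => g (a (U.map (isomAffine g⁻¹))) with hb
  have hbs : IsSection b := fun U hU => by
    have h1 := ha (U.map (isomAffine g⁻¹)) ((AffineSubspace.map_eq_bot_iff _).not.2 hU)
    have h2 := AffineSubspace.mem_map_of_mem (isomAffine g) h1
    rwa [hmap g g⁻¹ U (mul_inv_cancel g)] at h2
  have hF : push (AffineSubspace.map (isomAffine g)) z ∈ on IsFlag := by
    refine push_mem_on (fun u hu => ⟨fun i j hij => AffineSubspace.map_mono _ (hu.1 hij),
      fun i => ?_⟩) hzF
    exact (ProperFlat.map g ⟨u i, hu.2 i⟩).2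
  rw [evalFlag_eq p (g p) ha hbs (hz.map (isChainMap_push _)) hF]
  suffices h : evalFlag (g p) b ∘ₗ push (AffineSubspace.map (isomAffine g)) =
      isomSign n g • polytopeRep n g ∘ₗ evalFlag p a from LinearMap.congr_fun h z
  refine hom_ext fun u => ?_
  simp only [LinearMap.comp_apply, LinearMap.smul_apply, push_single, evalFlag_single]
  rw [← simplexClass_comp, Fin.comp_cons]
  congr 2
  funext i
  simp only [hb, Function.comp_apply]
  rw [hmap g⁻¹ g _ (inv_mul_cancel g)]

end

noncomputable section

/-! ## Germs along monomial curves -/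

open Filter Topology

/-- The lowest power of `t` dominates near `0`; it belongs to the largest index with nonzero
coefficient. -/
theorem eventually_sign_sum_eq {n : ℕ} (c : Fin (n + 1) → ℝ) (j : Fin (n + 1)) (hj : c j ≠ 0)
    (h : ∀ i, j < i → c i = 0) :
    ∀ᶠ t in 𝓝[>] (0 : ℝ), SignType.sign (∑ i, c i * t ^ (n - (i : ℕ))) = SignType.sign (c j) := by
  -- The sum with `t ^ (n - j)` factored out. For `i > j` the exponent truncates to `0`, which is
  -- harmless since `c i = 0`.
  set g : ℝ → ℝ := fun t => ∑ i, c i * t ^ ((j : ℕ) - (i : ℕ)) with hg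
  have hg0 : g 0 = c j := by
    rw [hg]
    dsimp only
    rw [Finset.sum_eq_single j]
    · simp
    · intro i _ hij
      rcases lt_or_gt_of_ne hij with hlt | hlt
      · rw [zero_pow (Nat.sub_ne_zero_of_lt hlt), mul_zero]
      · rw [h i hlt, zero_mul]
    · simp
  have hcont : Continuous g := by fun_prop
  have hev : ∀ᶠ t in 𝓝 (0 : ℝ), SignType.sign (g t) = SignType.sign (c j) := by
    have ht : Tendsto g (𝓝 0) (𝓝 (c j)) := hg0 ▸ hcont.tendsto 0
    rcases lt_or_gt_of_ne hj with hlt | hlt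
    · filter_upwards [ht.eventually (gt_mem_nhds hlt)] with t ht'
      rw [sign_neg ht', sign_neg hlt]
    · filter_upwards [ht.eventually (lt_mem_nhds hlt)] with t ht'
      rw [sign_pos ht', sign_pos hlt]
  filter_upwards [nhdsWithin_le_nhds hev, self_mem_nhdsWithin] with t ht ht0
  have ht0 : 0 < t := ht0
  have hfac : ∑ i, c i * t ^ (n - (i : ℕ)) = t ^ (n - (j : ℕ)) * g t := by
    rw [hg, Finset.mul_sum]
    refine Finset.sum_congr rfl fun i _ => ?_
    rcases lt_or_ge j i with hlt | hle
    · simp [h i hlt]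
    · have h1 : (i : ℕ) ≤ j := hle
      have h2 : (j : ℕ) ≤ n := Nat.lt_succ_iff.1 j.2
      rw [mul_left_comm, ← pow_add]
      congr 2
      omega
  rw [hfac, sign_mul, sign_pos (pow_pos ht0 _), one_mul, ht]

/-- The curve starting at the last point of `y`, with derivatives pointing towards or away from
the other points of `y` according to the signs `s`. -/
def signCurve {n : ℕ} (y : Fin (n + 1) → EuclSpace n) (s : Fin n → ℤˣ) (t : ℝ) : EuclSpace n :=
  y (Fin.last n) + ∑ i : Fin n,
    ((((s i : ℤˣ) : ℤ) : ℝ) * t ^ (n - (i : ℕ))) • (y i.castSucc - y (Fin.last n))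

/-- The signs `s`, followed by `1`. -/
def extSign {n : ℕ} (s : Fin n → ℤˣ) : Fin (n + 1) → ℝ :=
  Fin.snoc (α := fun _ => ℝ) (fun i => (((s i : ℤˣ) : ℤ) : ℝ)) 1

@[simp]
theorem extSign_castSucc {n : ℕ} (s : Fin n → ℤˣ) (i : Fin n) :
    extSign s i.castSucc = (((s i : ℤˣ) : ℤ) : ℝ) := by
  simp [extSign]

@[simp]
theorem extSign_last {n : ℕ} (s : Fin n → ℤˣ) : extSign s (Fin.last n) = 1 := by
  simp [extSign]

theorem extSign_ne_zero {n : ℕ} (s : Fin n → ℤˣ) (i : Fin (n + 1)) : extSign s i ≠ 0 := by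
  refine Fin.lastCases ?_ (fun i => ?_) i <;> simp

/-- `j` is the last index at which the affine function `f` does not vanish on `y`. -/
def IsLastNonzero {n : ℕ} (y : Fin (n + 1) → EuclSpace n) (f : EuclSpace n →ᵃ[ℝ] ℝ)
    (j : Fin (n + 1)) : Prop :=
  f (y j) ≠ 0 ∧ ∀ l, j < l → f (y l) = 0

theorem exists_isLastNonzero {n : ℕ} {y : Fin (n + 1) → EuclSpace n} {f : EuclSpace n →ᵃ[ℝ] ℝ}
    (h : ∃ i, f (y i) ≠ 0) : ∃ j, IsLastNonzero y f j := by
  classical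
  obtain ⟨j, hj, hmax⟩ := (Finset.univ.filter fun i => f (y i) ≠ 0).exists_max_image id
    (by obtain ⟨i, hi⟩ := h; exact ⟨i, by simpa using hi⟩)
  refine ⟨j, by simpa using hj, fun l hl => ?_⟩
  by_contra h'
  exact absurd (hmax l (by simpa using h')) (not_le.2 hl)

/-- Along the curve `f` is a polynomial in `t` in which the point `y i` contributes in degree `n -
i`, so the last point where `f` is nonzero decides the sign. -/
theorem eventually_sign_signCurve {n : ℕ} {y : Fin (n + 1) → EuclSpace n}
    {f : EuclSpace n →ᵃ[ℝ] ℝ} {j : Fin (n + 1)} (hj : IsLastNonzero y f j) (s : Fin n → ℤˣ) :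
    ∀ᶠ t in 𝓝[>] (0 : ℝ),
      SignType.sign (f (signCurve y s t)) = SignType.sign (extSign s j * f (y j)) := by
  set c : Fin (n + 1) → ℝ := Fin.snoc (α := fun _ => ℝ)
    (fun i => (((s i : ℤˣ) : ℤ) : ℝ) * (f (y i.castSucc) - f (y (Fin.last n))))
    (f (y (Fin.last n))) with hc
  have hcl : c (Fin.last n) = f (y (Fin.last n)) := by simp [hc]
  have hcc : ∀ i : Fin n, c i.castSucc =
      (((s i : ℤˣ) : ℤ) : ℝ) * (f (y i.castSucc) - f (y (Fin.last n))) := fun i => by simp [hc]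
  -- If `f` vanishes at all points after `i < n`, it vanishes at the last point, and the correction
  -- term disappears.
  have hval : ∀ i, (∀ l, i < l → f (y l) = 0) → c i = extSign s i * f (y i) := by
    intro i
    refine Fin.lastCases (fun _ => ?_) (fun i hi => ?_) i
    · simp [hcl]
    · rw [hcc, extSign_castSucc, hi _ (Fin.castSucc_lt_last i), sub_zero]
  have hcj := hval j hj.2
  have := eventually_sign_sum_eq c j (by rw [hcj]; exact mul_ne_zero (extSign_ne_zero s j) hj.1)
    fun i hi => by rw [hval i fun l hl => hj.2 l (hi.trans hl), hj.2 i hi, mul_zero]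
  filter_upwards [this] with t ht
  rw [← hcj, ← ht]
  congr 1
  rw [Fin.sum_univ_castSucc, hcl, signCurve, add_comm, ← vadd_eq_add, f.map_vadd, vadd_eq_add,
    map_sum]
  congr 1
  · refine Finset.sum_congr rfl fun i _ => ?_
    have := f.linearMap_vsub (y i.castSucc) (y (Fin.last n))
    rw [vsub_eq_sub, vsub_eq_sub] at this
    rw [map_smul, this, hcc, smul_eq_mul, Fin.val_castSucc]
    ring
  · simp

/-! ### Evaluating polytopes along ultrafilters -/

/-- An ultrafilter avoiding all proper flats. -/
def IsGeneric {n : ℕ} (v : Ultrafilter (EuclSpace n)) : Prop :=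
  ∀ V : Flat n, V ≠ ⊤ → (V : Set (EuclSpace n)) ∉ v

/-- A convex set without interior points spans a proper flat. -/
theorem IsGeneric.notMem_of_interior_eq_empty {n : ℕ} {v : Ultrafilter (EuclSpace n)}
    (hv : IsGeneric v) {s : Set (EuclSpace n)} (hs : Convex ℝ s) (h : interior s = ∅) :
    s ∉ v := by
  intro hm
  refine hv (affineSpan ℝ s) (fun h' => ?_) (mem_of_superset hm (subset_affineSpan ℝ s))
  rw [← hs.interior_nonempty_iff_affineSpan_eq_top, h] at h'
  exact Set.not_nonempty_empty h'

/-- The ultrafilter would contain one simplex from each polytope, hence their intersection, which is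
convex without interior points. -/
theorem IsGeneric.notMem_inter {n : ℕ} {v : Ultrafilter (EuclSpace n)} (hv : IsGeneric v)
    {s t : Set (EuclSpace n)} (hs : IsPolytope n s) (ht : IsPolytope n t)
    (h : interior (s ∩ t) = ∅) : ¬ (s ∈ v ∧ t ∈ v) := by
  rintro ⟨hsv, htv⟩
  obtain ⟨m, Δ, h1, -, rfl⟩ := hs
  obtain ⟨m', Δ', h1', -, rfl⟩ := ht
  have e : ∀ {k : ℕ} (A : Fin k → Set (EuclSpace n)), (⋃ i, A i) ∈ v → ∃ i, A i ∈ v := by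
    intro k A hA
    have := (Ultrafilter.finite_biUnion_mem_iff (f := v) (s := A) Set.finite_univ).1
      (by simpa using hA)
    simpa using this
  obtain ⟨i, hi⟩ := e Δ hsv
  obtain ⟨j, hj⟩ := e Δ' htv
  refine hv.notMem_of_interior_eq_empty ((h1 i).convex.inter (h1' j).convex) ?_
    (inter_mem hi hj)
  rw [← Set.subset_empty_iff, ← h]
  exact interior_mono (Set.inter_subset_inter (Set.subset_iUnion Δ i) (Set.subset_iUnion Δ' j))

open Classical in
/-- The homomorphism from the polytope module which tests whether a polytope belongs to a
generic ultrafilter. -/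
def ultraEval {n : ℕ} (v : Ultrafilter (EuclSpace n)) (hv : IsGeneric v) :
    PolytopeModule n →ₗ[ℤ] ℤ :=
  (polytopeRelations n).liftQ
    (Finsupp.linearCombination ℤ fun P : Polytope n => if P.carrier ∈ v then (1 : ℤ) else 0) (by
      refine Submodule.span_le.2 ?_
      rintro _ ⟨P, P', P'', h, rfl⟩
      have h1 := hv.notMem_inter P'.2 P''.2 h.2
      have h2 : P.carrier ∈ v ↔ P'.carrier ∈ v ∨ P''.carrier ∈ v := by
        rw [← Ultrafilter.union_mem_iff]
        exact iff_of_eq (congrArg (· ∈ v) h.1)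
      change ¬ (P'.carrier ∈ v ∧ P''.carrier ∈ v) at h1
      simp only [SetLike.mem_coe, LinearMap.mem_ker, map_sub, map_add,
        Finsupp.linearCombination_single, one_smul, h2]
      by_cases h3 : P'.carrier ∈ v <;> by_cases h4 : P''.carrier ∈ v <;> simp_all)

open Classical in
theorem ultraEval_polytopeClass {n : ℕ} (v : Ultrafilter (EuclSpace n)) (hv : IsGeneric v)
    {s : Set (EuclSpace n)} (hs : IsPolytope n s) :
    ultraEval v hv (polytopeClass s) = if s ∈ v then 1 else 0 := by
  rw [polytopeClass_of hs]
  refine (Finsupp.linearCombination_single ℤ _ _).trans ?_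
  rw [one_smul]
  rfl

/-- The ultrafilter of sets containing the points of a curve for arbitrarily small parameters. -/
def signUltrafilter {n : ℕ} (y : Fin (n + 1) → EuclSpace n) (s : Fin n → ℤˣ) :
    Ultrafilter (EuclSpace n) :=
  (Ultrafilter.of (𝓝[>] (0 : ℝ))).map (signCurve y s)

theorem mem_signUltrafilter {n : ℕ} {y : Fin (n + 1) → EuclSpace n} {s : Fin n → ℤˣ}
    {A : Set (EuclSpace n)} (h : ∀ᶠ t in 𝓝[>] (0 : ℝ), signCurve y s t ∈ A) :
    A ∈ signUltrafilter y s :=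
  Ultrafilter.mem_map.2 (Ultrafilter.of_le (𝓝[>] (0 : ℝ)) h)

theorem exists_affineMap_eq_zero {n : ℕ} {V : Flat n} (hV : V ≠ ⊤) (h : V ≠ ⊥) :
    ∃ f : EuclSpace n →ᵃ[ℝ] ℝ, (∀ x ∈ V, f x = 0) ∧ ∃ x, f x ≠ 0 := by
  obtain ⟨p, hp⟩ := (AffineSubspace.nonempty_iff_ne_bot V).2 h
  have hd : V.direction < ⊤ := lt_top_iff_ne_top.2 fun h' =>
    hV ((AffineSubspace.direction_eq_top_iff_of_nonempty ⟨p, hp⟩).1 h')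
  obtain ⟨f, hf, hle⟩ := Submodule.exists_le_ker_of_lt_top _ hd
  refine ⟨f.toAffineMap - AffineMap.const ℝ _ (f p), fun x hx => ?_, ?_⟩
  · have : x -ᵥ p ∈ V.direction := AffineSubspace.vsub_mem_direction hx hp
    have := hle this
    rw [LinearMap.mem_ker, vsub_eq_sub, map_sub] at this
    simpa using this
  · by_contra! h'
    refine hf (LinearMap.ext fun x => ?_)
    have := h' (x + p)
    simpa using this

/-- An affine function vanishing on a nonempty proper flat, but not identically, is nonzero at some
point of the spanning family `y`; so it is nonzero along the curve for small `t`. -/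
theorem isGeneric_signUltrafilter {n : ℕ} {y : Fin (n + 1) → EuclSpace n}
    (hy : AffineIndependent ℝ y) (s : Fin n → ℤˣ) : IsGeneric (signUltrafilter y s) := by
  intro V hV hm
  by_cases hb : V = ⊥
  · subst hb
    simp at hm
  obtain ⟨f, hf, x, hx⟩ := exists_affineMap_eq_zero hV hb
  have hi : ∃ i, f (y i) ≠ 0 := by
    by_contra! h
    have htop := hy.affineSpan_eq_top_iff_card_eq_finrank_add_one.2 (by simp)
    have hle : affineSpan ℝ (Set.range y) ≤
        (AffineSubspace.mk' (0 : ℝ) (⊥ : Submodule ℝ ℝ)).comap f := by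
      rw [affineSpan_le]
      rintro _ ⟨i, rfl⟩
      simp [h i]
    rw [htop] at hle
    have := hle (AffineSubspace.mem_top ℝ _ x)
    simp at this
    exact hx this
  obtain ⟨j, hj⟩ := exists_isLastNonzero hi
  have hc : (V : Set (EuclSpace n))ᶜ ∈ signUltrafilter y s := by
    refine mem_signUltrafilter ?_
    filter_upwards [eventually_sign_signCurve hj s] with t ht htV
    rw [hf _ htV, sign_zero, eq_comm, sign_eq_zero_iff] at ht
    exact mul_ne_zero (extSign_ne_zero s j) hj.1 ht
  exact Ultrafilter.compl_mem_iff_notMem.1 hc hm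

/-- Membership is a sign condition on each barycentric coordinate. No coordinate vanishes along the
curve for small `t`, so the weak inequalities are strict. -/
theorem convexHull_mem_signUltrafilter_iff {n : ℕ} {y : Fin (n + 1) → EuclSpace n}
    (b : AffineBasis (Fin (n + 1)) ℝ (EuclSpace n)) {j : Fin (n + 1) → Fin (n + 1)}
    (hj : ∀ k, IsLastNonzero y (b.coord k) (j k)) (s : Fin n → ℤˣ) :
    convexHull ℝ (Set.range b) ∈ signUltrafilter y s ↔
      ∀ k, 0 < extSign s (j k) * b.coord k (y (j k)) := by
  have hev : ∀ᶠ t in 𝓝[>] (0 : ℝ), (signCurve y s t ∈ convexHull ℝ (Set.range b) ↔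
      ∀ k, 0 < extSign s (j k) * b.coord k (y (j k))) := by
    filter_upwards [eventually_all.2 fun k => eventually_sign_signCurve (hj k) s] with t ht
    rw [b.convexHull_eq_nonneg_coord]
    refine forall_congr' fun k => ?_
    rw [← sign_nonneg_iff, ht k, sign_nonneg_iff, le_iff_lt_or_eq, or_iff_left]
    exact (mul_ne_zero (extSign_ne_zero s _) (hj k).1).symm
  by_cases h : ∀ k, 0 < extSign s (j k) * b.coord k (y (j k))
  · refine iff_of_true (mem_signUltrafilter ?_) h
    filter_upwards [hev] with t ht using ht.2 h
  · refine iff_of_false (Ultrafilter.compl_mem_iff_notMem.1 (mem_signUltrafilter ?_)) h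
    filter_upwards [hev] with t ht using fun h' => h (ht.1 h')

/-! ### The jump of a polytope along a flag -/

/-- The alternating sum of the germs of a polytope along the curves given by `y` and signs. -/
def jump {n : ℕ} (y : Fin (n + 1) → EuclSpace n) (hy : AffineIndependent ℝ y) :
    PolytopeModule n →ₗ[ℤ] ℤ :=
  ∑ s : Fin n → ℤˣ, ((∏ i, s i : ℤˣ) : ℤ) •
    ultraEval (signUltrafilter y s) (isGeneric_signUltrafilter hy s)

theorem jump_apply {n : ℕ} (y : Fin (n + 1) → EuclSpace n) (hy : AffineIndependent ℝ y)
    (x : PolytopeModule n) : jump y hy x = ∑ s : Fin n → ℤˣ, ((∏ i, s i : ℤˣ) : ℤ) *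
      ultraEval (signUltrafilter y s) (isGeneric_signUltrafilter hy s) x := by
  simp [jump]

/-- The affine basis given by affinely independent points. -/
def basisOfIndependent {n : ℕ} (y : Fin (n + 1) → EuclSpace n) (hy : AffineIndependent ℝ y) :
    AffineBasis (Fin (n + 1)) ℝ (EuclSpace n) :=
  ⟨y, hy, hy.affineSpan_eq_top_iff_card_eq_finrank_add_one.2 (by simp)⟩

/-- The sign `s i` enters no membership condition, so flipping it pairs off the terms of the sum
with opposite signs. -/
theorem jump_eq_zero {n : ℕ} {y b : Fin (n + 1) → EuclSpace n} (hy : AffineIndependent ℝ y)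
    (hb : AffineIndependent ℝ b) {j : Fin (n + 1) → Fin (n + 1)}
    (hj : ∀ k, IsLastNonzero y ((basisOfIndependent b hb).coord k) (j k)) {i : Fin n}
    (hi : ∀ k, j k ≠ i.castSucc) :
    jump y hy (polytopeClass (convexHull ℝ (Set.range b))) = 0 := by
  classical
  rw [jump_apply]
  refine Finset.sum_involution (fun s _ => Function.update s i (-s i)) (fun s _ => ?_)
    (fun s _ _ h => ?_) (fun _ _ => Finset.mem_univ _) (fun s _ => ?_)
  · have hP : IsPolytope n (convexHull ℝ (Set.range b)) :=
      IsGeodesicSimplex.isPolytope ⟨b, hb, rfl⟩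
    have hext : ∀ k, extSign (Function.update s i (-s i)) (j k) = extSign s (j k) := by
      intro k
      have := hi k
      revert this
      refine Fin.lastCases (fun _ => by simp) (fun l hl => ?_) (j k)
      rw [extSign_castSucc, extSign_castSucc, Function.update_of_ne]
      rintro rfl
      exact hl rfl
    have hm : convexHull ℝ (Set.range b) ∈ signUltrafilter y (Function.update s i (-s i)) ↔
        convexHull ℝ (Set.range b) ∈ signUltrafilter y s := by
      refine (convexHull_mem_signUltrafilter_iff (basisOfIndependent b hb) hj _).trans
        (Iff.trans ?_ (convexHull_mem_signUltrafilter_iff (basisOfIndependent b hb) hj _).symm)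
      simp only [hext]
    rw [ultraEval_polytopeClass _ _ hP, ultraEval_polytopeClass _ _ hP, if_congr hm rfl rfl,
      ← add_mul, Finset.prod_update_of_mem (Finset.mem_univ i),
      ← Finset.mul_prod_erase _ _ (Finset.mem_univ i), Finset.sdiff_singleton_eq_erase]
    simp
  · have := congrFun h i
    rw [Function.update_self] at this
    rcases Int.units_eq_one_or (s i) with h' | h' <;> rw [h'] at this <;>
      exact absurd this (by decide)
  · simp

/-- Coordinate `k` is nonzero only at `y k`, so membership forces every sign to be `1`. -/
theorem jump_self {n : ℕ} {y : Fin (n + 1) → EuclSpace n} (hy : AffineIndependent ℝ y) :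
    jump y hy (polytopeClass (convexHull ℝ (Set.range y))) = 1 := by
  classical
  have hP : IsPolytope n (convexHull ℝ (Set.range y)) :=
    IsGeodesicSimplex.isPolytope ⟨y, hy, rfl⟩
  have hc : ∀ k l, (basisOfIndependent y hy).coord k (y l) = if k = l then 1 else 0 :=
    fun k l => (basisOfIndependent y hy).coord_apply k l
  have hj : ∀ k, IsLastNonzero y ((basisOfIndependent y hy).coord k) k := fun k =>
    ⟨by simp [hc], fun l hl => by simp [hc, hl.ne]⟩
  rw [jump_apply, Finset.sum_eq_single 1]
  · rw [ultraEval_polytopeClass _ _ hP, if_pos]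
    · simp
    · refine (convexHull_mem_signUltrafilter_iff (basisOfIndependent y hy) hj 1).2 fun k => ?_
      rw [hc, if_pos rfl, mul_one]
      refine Fin.lastCases ?_ (fun i => ?_) k <;> simp
  · intro s _ hs
    rw [ultraEval_polytopeClass _ _ hP, if_neg, mul_zero]
    intro h
    have h := (convexHull_mem_signUltrafilter_iff (basisOfIndependent y hy) hj s).1 h
    refine hs (funext fun i => ?_)
    have hi := h i.castSucc
    rw [hc, if_pos rfl, mul_one, extSign_castSucc] at hi
    rcases Int.units_eq_one_or (s i) with h' | h'
    · exact h'
    · rw [h'] at hi; norm_num at hi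
  · simp

end

noncomputable section

/-! ## Detecting flags by jumps -/

open TupleChain

theorem affineIndependent_cons {n m : ℕ} {p : EuclSpace n} {y : Fin m → EuclSpace n}
    (hy : AffineIndependent ℝ y) (hp : p ∉ affineSpan ℝ (Set.range y)) :
    AffineIndependent ℝ (Fin.cons p y : Fin (m + 1) → EuclSpace n) := by
  rw [affineIndependent_iff_sum]
  intro w h0 h1
  rw [Fin.sum_univ_succ] at h0 h1
  simp only [Fin.cons_zero, Fin.cons_succ] at h0 h1
  have hw : w 0 = 0 := by
    by_contra hw
    refine hp ?_
    have h0' : ∑ i : Fin m, -(w 0)⁻¹ * w i.succ = 1 := by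
      rw [← Finset.mul_sum, eq_neg_of_add_eq_zero_right h0]
      field_simp
    have : p = Finset.univ.affineCombination ℝ y fun i : Fin m => -(w 0)⁻¹ * w i.succ := by
      rw [Finset.univ.affineCombination_eq_linear_combination _ _ h0']
      simp only [mul_smul, ← Finset.smul_sum]
      rw [eq_neg_of_add_eq_zero_right h1, smul_neg, neg_smul, neg_neg, smul_smul,
        inv_mul_cancel₀ hw, one_smul]
    rw [this]
    exact affineCombination_mem_affineSpan h0' y
  rw [hw, zero_add] at h0
  rw [hw, zero_smul, zero_add] at h1
  exact fun i => Fin.cases hw ((affineIndependent_iff_sum y).1 hy _ h0 h1) i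

theorem mem_affineSpan_of_coord_eq_zero {n : ℕ} {ι : Type} [Fintype ι] [DecidableEq ι]
    (b : AffineBasis ι ℝ (EuclSpace n)) (S : Finset ι) (x : EuclSpace n)
    (h : ∀ k ∉ S, b.coord k x = 0) : x ∈ affineSpan ℝ (b '' (S : Set ι)) := by
  have h1 : ∑ k ∈ S, b.coord k x = 1 := by
    rw [← b.sum_coord_apply_eq_one x]
    exact Finset.sum_subset (Finset.subset_univ S) fun k _ hk => h k hk
  have h2 : x = S.affineCombination ℝ b fun k => b.coord k x := by
    rw [S.affineCombination_eq_linear_combination _ _ h1,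
      Finset.sum_subset (Finset.subset_univ S) fun k _ hk => by rw [h k hk, zero_smul],
      b.linear_combination_coord_eq_self]
  rw [h2]
  exact affineCombination_mem_affineSpan_image h1 (s' := (S : Set ι))
    (fun k hk hk' => absurd hk hk') b

/-- If the points `y i`, `i ∈ T`, lie in the span of as many points of an affine basis, then
those points lie in the span of the former. -/
theorem mem_affineSpan_of_card_eq {n : ℕ} {ι : Type} [Fintype ι] [DecidableEq ι]
    {b y : ι → EuclSpace n} (hb : AffineIndependent ℝ b) (hy : AffineIndependent ℝ y)
    {S T : Finset ι} (hcard : T.card = S.card)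
    (h : ∀ i ∈ T, y i ∈ affineSpan ℝ (b '' (S : Set ι))) {k : ι} (hk : k ∈ S) :
    b k ∈ affineSpan ℝ (y '' (T : Set ι)) := by
  classical
  obtain ⟨m, hm⟩ : ∃ m, S.card = m + 1 :=
    ⟨S.card - 1, (Nat.sub_add_cancel (Finset.card_pos.2 ⟨k, hk⟩)).symm⟩
  have hfr : Module.finrank ℝ (affineSpan ℝ (b '' (S : Set ι))).direction = m := by
    rw [direction_affineSpan, ← Finset.coe_image]
    exact hb.finrank_vectorSpan_image_finset hm
  have := hy.affineSpan_image_finset_eq_of_le_of_card_eq_finrank_add_one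
    (s := T) (sp := affineSpan ℝ (b '' (S : Set ι))) (by
      rw [affineSpan_le]
      intro x hx
      obtain ⟨i, hi, rfl⟩ := Finset.mem_image.1 (Finset.mem_coe.1 hx)
      exact h i hi) (by rw [hfr, hcard, hm])
  rw [Finset.coe_image] at this
  rw [this]
  exact subset_affineSpan ℝ _ ⟨k, hk, rfl⟩

/-- If the last nonzero entries of the barycentric coordinates of `y` in the basis `b` occur at
all indices, then the span of every final segment of `y` contains as many elements of `b`. -/
theorem exists_mem_affineSpan_of_surjective {n : ℕ} {y b : Fin (n + 1) → EuclSpace n}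
    (hy : AffineIndependent ℝ y) (hb : AffineIndependent ℝ b) {j : Fin (n + 1) → Fin (n + 1)}
    (hj : ∀ k, IsLastNonzero y ((basisOfIndependent b hb).coord k) (j k))
    (hi : ∀ i : Fin n, ∃ k, j k = i.castSucc) (i : Fin n) (hn : ∀ k, b k ∈
      affineSpan ℝ (y '' {l | i.castSucc < l}) → i.succ < k) : False := by
  classical
  -- The coordinates of the last point sum to `1`, so one of them is nonzero there.
  have hlast : ∃ k, j k = Fin.last n := by
    by_contra! h
    have h1 := (basisOfIndependent b hb).sum_coord_apply_eq_one (y (Fin.last n))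
    rw [Finset.sum_eq_zero fun k _ => (hj k).2 _ (lt_of_le_of_ne (Fin.le_last _) (h k))] at h1
    exact zero_ne_one h1
  have hsurj : Function.Surjective j := fun l => Fin.lastCases hlast hi l
  have hbij : Function.Bijective j := Finite.injective_iff_bijective.1
    (Finite.injective_iff_surjective.2 hsurj)
  -- Past position `i`, only the coordinates in `S` can be nonzero. So the final segment `T` of `y`
  -- lies in the span of the points `b k` with `k ∈ S`, and equal cardinality makes the two spans
  -- equal.
  set S : Finset (Fin (n + 1)) := Finset.univ.filter fun k => i.castSucc < j k with hS
  set T : Finset (Fin (n + 1)) := Finset.univ.filter fun l => i.castSucc < l with hT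
  have hcard : T.card = S.card := by
    symm
    refine Finset.card_bijective j hbij fun k => ?_
    simp [hS, hT]
  have hTc : T.card = n - i := by
    have : T = Finset.Ioi i.castSucc := by ext l; simp [hT]
    rw [this, Fin.card_Ioi]
    simp
  have hmem : ∀ k ∈ S, b k ∈ affineSpan ℝ (y '' (T : Set (Fin (n + 1)))) := fun k hk => by
    refine mem_affineSpan_of_card_eq hb hy hcard (fun l hl => ?_) hk
    refine mem_affineSpan_of_coord_eq_zero (basisOfIndependent b hb) S _ fun k' hk' => ?_
    refine (hj k').2 l (lt_of_le_of_lt (not_lt.1 fun h => hk' ?_) (Finset.mem_filter.1 hl).2)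
    exact Finset.mem_filter.2 ⟨Finset.mem_univ _, h⟩
  -- `S` has `n - i` elements, but only `n - i - 1` indices exceed `i.succ`.
  have hsub : S ⊆ Finset.Ioi i.succ := fun k hk => by
    rw [Finset.mem_Ioi]
    refine hn k ?_
    have := hmem k hk
    rwa [hT, Finset.coe_filter_univ] at this
  have := Finset.card_le_card hsub
  rw [← hcard, hTc, Fin.card_Ioi] at this
  have := i.2
  simp at *
  omega

/-! ### Strict flags -/

theorem strictAnti_of_not_degenerate {n m : ℕ} {u : Fin m → Flat n} (hu : Antitone u)
    (h : ¬ Degenerate u) : StrictAnti u := by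
  cases m with
  | zero => exact fun i => i.elim0
  | succ m =>
    rw [Fin.strictAnti_iff_succ_lt]
    refine fun i => lt_of_le_of_ne (hu (Fin.castSucc_lt_succ).le) fun e => h ?_
    exact ⟨i, by omega, e.symm⟩

theorem finrank_direction_lt {n : ℕ} {U V : Flat n} (hU : U ≠ ⊥) (h : U < V) :
    Module.finrank ℝ U.direction < Module.finrank ℝ V.direction :=
  Submodule.finrank_lt_finrank_of_lt (AffineSubspace.direction_lt_of_nonempty h
    ((AffineSubspace.nonempty_iff_ne_bot U).2 hU))

/-- The dimensions of the members of a flag of proper flats. -/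
def flagDim {n m : ℕ} {u : Fin m → Flat n} (hu : IsFlag u) (i : Fin m) : Fin n :=
  ⟨Module.finrank ℝ (u i).direction, by
    have := finrank_direction_lt (hu.2 i).1 (lt_top_iff_ne_top.2 (hu.2 i).2)
    rwa [AffineSubspace.direction_top, finrank_top, finrank_euclideanSpace_fin] at this⟩

theorem strictAnti_flagDim {n m : ℕ} {u : Fin m → Flat n} (hu : IsFlag u) (h : StrictAnti u) :
    StrictAnti (flagDim hu) :=
  fun _ j hij => finrank_direction_lt (hu.2 j).1 (h hij)

theorem IsFlag.degenerate_of_lt {n m : ℕ} {u : Fin m → Flat n} (hu : IsFlag u) (h : n < m) :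
    Degenerate u := by
  by_contra h'
  have := Fintype.card_le_of_injective _
    (strictAnti_flagDim hu (strictAnti_of_not_degenerate hu.1 h')).injective
  simp at this
  omega

/-- A strict flag of `n` proper flats takes each dimension `n - 1, …, 0` once, so corresponding
members have equal dimension. -/
theorem IsFlag.eq_of_le {n : ℕ} {u w : Fin n → Flat n} (hu : IsFlag u) (hw : IsFlag w)
    (hu' : StrictAnti u) (hw' : StrictAnti w) (h : ∀ i, u i ≤ w i) : u = w := by
  have h1 := strictAnti_flagDim hu hu'
  have h2 := strictAnti_flagDim hw hw'
  have h3 : ∀ i, flagDim hu i = flagDim hw i := by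
    have key : ∀ {f : Fin n → Fin n}, StrictAnti f → Set.range f = Set.univ := fun hf =>
      (Finite.injective_iff_surjective.1 hf.injective).range_eq
    exact fun i => OrderDual.toDual.injective (congrFun ((StrictMono.range_inj
      (f := fun i => OrderDual.toDual (flagDim hu i)) (g := fun i => OrderDual.toDual (flagDim hw i))
      (fun _ _ h => h1 h) (fun _ _ h => h2 h)).1 ((key h1).trans (key h2).symm)) i)
  funext i
  refine AffineSubspace.eq_of_direction_eq_of_nonempty_of_le
    (Submodule.eq_of_le_of_finrank_eq (AffineSubspace.direction_le (h i)) ?_)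
    ((AffineSubspace.nonempty_iff_ne_bot _).2 (hu.2 i).1) (h i)
  exact congrArg Fin.val (h3 i)

/-- Every nonempty flat has a point lying only in those members of a chain which contain it. -/
theorem exists_generic_point {n m : ℕ} {w : Fin m → Flat n} (hw : Antitone w) {U : Flat n}
    (hU : U ≠ ⊥) : ∃ p ∈ U, ∀ j, p ∈ w j → U ≤ w j := by
  classical
  rcases (Finset.univ.filter fun j => ¬ U ≤ w j).eq_empty_or_nonempty with h | h
  · obtain ⟨p, hp⟩ := (AffineSubspace.nonempty_iff_ne_bot U).2 hU
    refine ⟨p, hp, fun j _ => ?_⟩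
    by_contra h'
    exact (Finset.eq_empty_iff_forall_notMem.1 h j) (by simp [h'])
  -- The first member not containing `U` is the largest such; a point of `U` outside it avoids all
  -- later ones.
  · obtain ⟨j₀, hj₀, hmin⟩ := Finset.exists_min_image _ id h
    obtain ⟨p, hp, hp'⟩ := SetLike.not_le_iff_exists.1 (Finset.mem_filter.1 hj₀).2
    refine ⟨p, hp, fun j hj => ?_⟩
    by_contra h'
    exact hp' (hw (hmin j (by simp [h'])) hj)

/-- Genericity keeps the point of `w 0` out of `w 1`, which contains all the later points. -/
theorem affineIndependent_comp_of_strictAnti {n m : ℕ} {w : Fin m → Flat n} (hw : StrictAnti w)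
    (hb : ∀ i, w i ≠ ⊥) {a : Flat n → EuclSpace n} (ha : IsSection a)
    (haw : ∀ i j, a (w i) ∈ w j → w i ≤ w j) : AffineIndependent ℝ (a ∘ w) := by
  induction m with
  | zero => exact affineIndependent_of_subsingleton ℝ _
  | succ m ih =>
    have := ih (w := Fin.tail w) (fun i j h => hw (Fin.succ_lt_succ_iff.2 h)) (fun i => hb _)
      fun i j => haw _ _
    rw [← Fin.cons_self_tail w, Fin.comp_cons]
    refine affineIndependent_cons this fun h => ?_
    cases m with
    | zero =>
      rw [Set.range_eq_empty, AffineSubspace.span_empty] at h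
      exact AffineSubspace.notMem_bot ℝ _ _ h
    | succ m =>
      have hle : affineSpan ℝ (Set.range (a ∘ Fin.tail w)) ≤ w 1 := by
        rw [affineSpan_le]
        rintro _ ⟨i, rfl⟩
        exact hw.antitone (Fin.succ_le_succ_iff.2 (Fin.zero_le i)) (ha _ (hb _))
      exact absurd (haw 0 1 (hle h)) (hw Fin.zero_lt_one).not_ge

/-- A homomorphism on the polytope module which recovers a coefficient of a cycle of flags. -/
theorem exists_jump_evalFlag {n : ℕ} {w : Fin n → Flat n} (hw : IsFlag w) (hw' : StrictAnti w) :
    ∃ (p : EuclSpace n) (a : Flat n → EuclSpace n) (f : PolytopeModule n →ₗ[ℤ] ℤ) (c : ℤ),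
      IsSection a ∧ c ≠ 0 ∧ ∀ z ∈ on IsFlag, f (evalFlag p a z) = c * z w := by
  classical
  -- The section is chosen generic relative to `w`: `a U` lies in `w j` only if all of `U` does.
  -- Below, `p` is generic for the whole space, hence in no `w j`.
  have hex : ∀ U : Flat n, ∃ p, U ≠ ⊥ → p ∈ U ∧ ∀ j, p ∈ w j → U ≤ w j := fun U => by
    by_cases hU : U = ⊥
    · exact ⟨0, fun h => absurd hU h⟩
    · obtain ⟨p, hp⟩ := exists_generic_point hw.1 hU
      exact ⟨p, fun _ => hp⟩
  choose a ha using hex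
  have has : IsSection a := fun U hU => (ha U hU).1
  obtain ⟨p, -, hp⟩ := exists_generic_point hw.1 (U := ⊤)
    (AffineSubspace.bot_ne_top ℝ _ _).symm
  have hp' : ∀ j, p ∉ w j := fun j hj => (hw.2 j).2 (top_le_iff.1 (hp j hj))
  set y : Fin (n + 1) → EuclSpace n := Fin.cons p (a ∘ w) with hydef
  have hy : AffineIndependent ℝ y := by
    refine affineIndependent_cons (affineIndependent_comp_of_strictAnti hw'
      (fun i => (hw.2 i).1) has fun i j => (ha _ (hw.2 i).1).2 j) fun h => ?_
    cases n with
    | zero =>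
      rw [Set.range_eq_empty, AffineSubspace.span_empty] at h
      exact AffineSubspace.notMem_bot ℝ _ _ h
    | succ n =>
      refine hp' 0 ((affineSpan_le.2 ?_) h)
      rintro _ ⟨i, rfl⟩
      exact hw.1 (Fin.zero_le i) (has _ (hw.2 i).1)
  -- `jump` is `1` on the unoriented simplex of `w`, so the coefficient appears multiplied by the
  -- orientation sign.
  refine ⟨p, a, jump y hy, SignType.sign (orientDet y), has, ?_, fun z hz => ?_⟩
  · have := (orientDet_ne_zero_iff y).2 hy
    rcases lt_or_gt_of_ne this with h | h <;> simp [h]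
  refine map_eq_of_on (f := jump y hy ∘ₗ evalFlag p a)
    (g := (((SignType.sign (orientDet y) : SignType) : ℤ)) • Finsupp.lapply w)
    (fun u hu => ?_) hz
  rw [LinearMap.comp_apply, evalFlag_single, LinearMap.smul_apply, Finsupp.lapply_apply]
  by_cases huw : u = w
  · subst huw
    rw [Finsupp.single_eq_same, simplexClass, map_zsmul, jump_self]
  rw [Finsupp.single_eq_of_ne (Ne.symm huw), smul_zero]
  by_cases hb : AffineIndependent ℝ (Fin.cons p (a ∘ u) : Fin (n + 1) → EuclSpace n)
  swap
  · rw [simplexClass_of_not_affineIndependent hb, map_zero]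
  have hu' : StrictAnti u := by
    refine strictAnti_of_not_degenerate hu.1 ?_
    rintro ⟨i, h, e⟩
    have := hb.injective (a₁ := Fin.succ ⟨i, by omega⟩) (a₂ := Fin.succ ⟨i + 1, h⟩)
      (congrArg a e)
    simp at this
  rw [simplexClass, map_zsmul]
  -- A coordinate vanishing at all points of `y` would vanish everywhere, since `y` spans.
  have hnz : ∀ k, ∃ i, (basisOfIndependent _ hb).coord k (y i) ≠ 0 := by
    intro k
    by_contra! h
    have h1 := mem_affineSpan_of_coord_eq_zero (basisOfIndependent y hy) Finset.univ
      (basisOfIndependent _ hb k) (by simp)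
    have h2 : affineSpan ℝ (Set.range y) ≤
        (AffineSubspace.mk' (0 : ℝ) (⊥ : Submodule ℝ ℝ)).comap
          ((basisOfIndependent _ hb).coord k) := by
      rw [affineSpan_le]
      rintro _ ⟨i, rfl⟩
      simp [h i]
    rw [Finset.coe_univ, Set.image_univ] at h1
    have := h2 h1
    simp at this
  choose j hj using fun k => exists_isLastNonzero (hnz k)
  by_cases hs : ∀ i : Fin n, ∃ k, j k = i.castSucc
  swap
  · push Not at hs
    obtain ⟨i, hi⟩ := hs
    rw [jump_eq_zero hy hb hj hi, smul_zero]
  -- All positions now occur as last nonzero indices. If `u i` were not inside `w i`, genericity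
  -- would allow a vertex of `u` in `w i` only at index above `i.succ`, too few for the dimension
  -- count.
  refine absurd (hu.eq_of_le hw hu' hw' fun i => ?_) huw
  by_contra hle
  refine exists_mem_affineSpan_of_surjective hy hb hj hs i fun k hk => ?_
  have hspan : affineSpan ℝ (y '' {l | i.castSucc < l}) ≤ w i := by
    rw [affineSpan_le]
    rintro _ ⟨l, hl, rfl⟩
    obtain ⟨l', rfl⟩ := Fin.exists_succ_eq.2 (Fin.ne_zero_of_lt hl)
    exact hw.1 (Fin.castSucc_lt_succ_iff.1 hl) (has _ (hw.2 l').1)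
  have hkw := hspan hk
  induction k using Fin.cases with
  | zero => exact absurd hkw (hp' i)
  | succ k =>
    rw [Fin.succ_lt_succ_iff]
    by_contra hki
    exact hle ((hu.1 (not_lt.1 hki)).trans ((ha _ (hu.2 k).1).2 i hkw))

/-- A cycle of flags whose class vanishes is a boundary. -/
theorem exists_d_eq_of_evalFlag_eq_zero {n : ℕ} {q : EuclSpace n} {b : Flat n → EuclSpace n}
    (hb : IsSection b) {z : TupleChain n (Flat n)} (hz : IsCycle z) (hzF : z ∈ on IsFlag)
    (h : evalFlag q b z = 0) : ∃ v ∈ on IsFlag, z = d n v := by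
  refine exists_d_eq_of_degenerate hz hzF ((Finsupp.mem_supported' ℤ z).2 fun w hw => ?_)
  by_cases hwF : IsFlag w
  · obtain ⟨p, a, f, c, ha, hc, hf⟩ := exists_jump_evalFlag hwF
      (strictAnti_of_not_degenerate hwF.1 hw)
    have := hf z hzF
    rw [evalFlag_eq p q ha hb hz hzF, h, map_zero, eq_comm, mul_eq_zero] at this
    exact this.resolve_left hc
  · exact (Finsupp.mem_supported' ℤ z).1 hzF w hwF

end

noncomputable section

/-! ## Homology of complexes of abelian groups in terms of elements -/

theorem ModuleCat.toSpanSingleton_one {R : Type} [Ring R] {M : ModuleCat.{0} R} (x : M) :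
    LinearMap.toSpanSingleton R M x 1 = x :=
  one_smul R x

theorem ModuleCat.linearCombination_single_one {R : Type} [Ring R] {M : ModuleCat.{0} R}
    {α : Type} (f : α → M) (u : α) :
    Finsupp.linearCombination R f (Finsupp.single u 1) = f u := by
  simp

section Elements

variable (K : ChainComplex (ModuleCat.{0} ℤ) ℕ) (m : ℕ)

theorem subsingleton_homology_of_forall_exists
    (h : ∀ z : K.X m, (K.d m ((ComplexShape.down ℕ).next m)).hom z = 0 →
      ∃ w, (K.d (m + 1) m).hom w = z) : Subsingleton (K.homology m) := by
  have h1 : K.ExactAt m := by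
    rw [K.exactAt_iff' (m + 1) m ((ComplexShape.down ℕ).next m) (ChainComplex.prev ℕ m) rfl,
      ShortComplex.moduleCat_exact_iff]
    exact h
  exact ModuleCat.subsingleton_of_isZero ((K.exactAt_iff_isZero_homology m).1 h1)

variable {K m} {A : ModuleCat.{0} ℤ} (φ : K.X m ⟶ A) (hφ : K.d (m + 1) m ≫ φ = 0)

/-- The map from homology induced by a map of chains vanishing on boundaries. -/
def homologyDesc : K.homology m ⟶ A :=
  K.homologyι m ≫ K.descOpcycles φ (m + 1) (ChainComplex.prev ℕ m) hφ

theorem homologyπ_homologyDesc : K.homologyπ m ≫ homologyDesc φ hφ = K.iCycles m ≫ φ := by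
  simp [homologyDesc]

theorem homologyDesc_homologyπ (z : K.cycles m) :
    (homologyDesc φ hφ).hom ((K.homologyπ m).hom z) = φ.hom ((K.iCycles m).hom z) :=
  LinearMap.congr_fun (congrArg ModuleCat.Hom.hom (homologyπ_homologyDesc φ hφ)) z

theorem homologyπ_surjective : Function.Surjective (K.homologyπ m).hom :=
  (ModuleCat.epi_iff_surjective _).1 inferInstance

theorem d_iCycles (z : K.cycles m) :
    (K.d m ((ComplexShape.down ℕ).next m)).hom ((K.iCycles m).hom z) = 0 :=
  LinearMap.congr_fun (congrArg ModuleCat.Hom.hom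
    (K.iCycles_d m ((ComplexShape.down ℕ).next m))) z

theorem homologyDesc_injective
    (h : ∀ z : K.X m, (K.d m ((ComplexShape.down ℕ).next m)).hom z = 0 → φ.hom z = 0 →
      ∃ w, (K.d (m + 1) m).hom w = z) : Function.Injective (homologyDesc φ hφ).hom := by
  rw [injective_iff_map_eq_zero]
  intro x hx
  obtain ⟨z, rfl⟩ := homologyπ_surjective x
  rw [homologyDesc_homologyπ] at hx
  obtain ⟨w, hw⟩ := h _ (d_iCycles z) hx
  have hi : Function.Injective (K.iCycles m).hom :=
    (ModuleCat.mono_iff_injective _).1 inferInstance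
  have : (K.toCycles (m + 1) m).hom w = z := hi (by
    rw [← hw]
    exact LinearMap.congr_fun (congrArg ModuleCat.Hom.hom (K.toCycles_i (m + 1) m)) w)
  rw [← this]
  exact LinearMap.congr_fun (congrArg ModuleCat.Hom.hom (K.toCycles_comp_homologyπ (m + 1) m)) w

theorem exists_iCycles_eq {z : K.X m}
    (hz : (K.d m ((ComplexShape.down ℕ).next m)).hom z = 0) :
    ∃ c : K.cycles m, (K.iCycles m).hom c = z := by
  let k : ModuleCat.of ℤ ℤ ⟶ K.X m := ModuleCat.ofHom (LinearMap.toSpanSingleton ℤ _ z)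
  have hk : k ≫ K.d m ((ComplexShape.down ℕ).next m) = 0 := by
    ext
    simpa [k] using hz
  refine ⟨(K.liftCycles k _ rfl hk).hom (1 : ℤ), ?_⟩
  have := LinearMap.congr_fun (congrArg ModuleCat.Hom.hom (K.liftCycles_i k _ rfl hk)) (1 : ℤ)
  exact this.trans (ModuleCat.toSpanSingleton_one z)

end Elements

/-! ## Simplicial chains of the Tits complex as chains of flags -/

open TupleChain

section Chains

variable {X Y : SSet.{0}} {k : ℕ}

/-- The generator of the simplicial chains corresponding to a simplex. -/
def simplexChain (x : X _⦋k⦌) : (X.chainComplex (ModuleCat.of ℤ ℤ)).X k :=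
  (X.ιChainComplex (R := ModuleCat.of ℤ ℤ) x).hom (1 : ℤ)

theorem simplexChain_hom_ext {M : ModuleCat.{0} ℤ}
    {f g : (X.chainComplex (ModuleCat.of ℤ ℤ)).X k →ₗ[ℤ] M}
    (h : ∀ x, f (simplexChain x) = g (simplexChain x)) : f = g := by
  have : ModuleCat.ofHom f = ModuleCat.ofHom g := SSet.chainComplex_hom_ext fun x => by
    ext
    exact h x
  exact congrArg ModuleCat.Hom.hom this

/-- A linear map on simplicial chains given by its values on simplices. -/
def simplexDesc {M : Type} [AddCommGroup M] (f : X _⦋k⦌ → M) :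
    (X.chainComplex (ModuleCat.of ℤ ℤ)).X k ⟶ ModuleCat.of ℤ M :=
  Sigma.desc fun x => ModuleCat.ofHom (LinearMap.toSpanSingleton ℤ M (f x))

theorem simplexDesc_simplexChain {M : Type} [AddCommGroup M] (f : X _⦋k⦌ → M) (x : X _⦋k⦌) :
    (simplexDesc f).hom (simplexChain x) = f x := by
  have h : X.ιChainComplex (R := ModuleCat.of ℤ ℤ) x ≫ simplexDesc f =
      ModuleCat.ofHom (LinearMap.toSpanSingleton ℤ M (f x)) := Sigma.ι_desc _ _
  refine (LinearMap.congr_fun (congrArg ModuleCat.Hom.hom h) (1 : ℤ)).trans ?_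
  simp

theorem d_simplexChain (x : X _⦋k + 1⦌) :
    ((X.chainComplex (ModuleCat.of ℤ ℤ)).d (k + 1) k).hom (simplexChain x) =
      ∑ i : Fin (k + 2), (-1 : ℤ) ^ (i : ℕ) • simplexChain (X.δ i x) := by
  refine (LinearMap.congr_fun (congrArg ModuleCat.Hom.hom
    (X.ιChainComplex_d (ModuleCat.of ℤ ℤ) x)) (1 : ℤ)).trans ?_
  simp [simplexChain]

theorem map_simplexChain (f : X ⟶ Y) (x : X _⦋k⦌) :
    ((SSet.chainComplexMap f (ModuleCat.of ℤ ℤ)).f k).hom (simplexChain x) =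
      simplexChain (f.app _ x) :=
  LinearMap.congr_fun (congrArg ModuleCat.Hom.hom
    (SSet.ι_chainComplexMap_f X Y f (ModuleCat.of ℤ ℤ) x)) (1 : ℤ)

theorem augmentation_simplexChain (x : X _⦋0⦌) :
    (simplicialAugmentation X).hom (simplexChain x) = (1 : ℤ) :=
  LinearMap.congr_fun (congrArg ModuleCat.Hom.hom (ι_simplicialAugmentation X x)) (1 : ℤ)

end Chains

/-- A simplex of the Tits complex as a functor. -/
def toArrows {n k : ℕ} (x : (titsComplex n) _⦋k⦌) : ComposableArrows (ProperFlat n)ᵒᵈ k := x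

/-- The flats of a simplex of the Tits complex. -/
def flagOf {n k : ℕ} (x : (titsComplex n) _⦋k⦌) : Fin (k + 1) → Flat n := fun i =>
  (OrderDual.ofDual ((toArrows x).obj i)).1

theorem isFlag_flagOf {n k : ℕ} (x : (titsComplex n) _⦋k⦌) : IsFlag (flagOf x) :=
  ⟨fun _ _ h => leOfHom ((toArrows x).map (homOfLE h)),
    fun i => (OrderDual.ofDual ((toArrows x).obj i)).2⟩

/-- The simplex of the Tits complex given by a flag. -/
def simplexOf {n k : ℕ} (u : Fin (k + 1) → Flat n) (hu : IsFlag u) : (titsComplex n) _⦋k⦌ :=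
  (Monotone.functor (f := fun i => OrderDual.toDual (⟨u i, hu.2 i⟩ : ProperFlat n))
    fun _ _ h => hu.1 h : Fin (k + 1) ⥤ (ProperFlat n)ᵒᵈ)

theorem flagOf_simplexOf {n k : ℕ} (u : Fin (k + 1) → Flat n) (hu : IsFlag u) :
    flagOf (simplexOf u hu) = u := rfl

theorem simplexOf_flagOf {n k : ℕ} (x : (titsComplex n) _⦋k⦌) :
    simplexOf (flagOf x) (isFlag_flagOf x) = x :=
  nerve.ext_of_isThin rfl

/-- The chain of flags underlying an augmented simplicial chain of the Tits complex. -/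
def toFlags {n : ℕ} (m : ℕ) :
    (augmentedChainComplex (titsComplex n)).X m →ₗ[ℤ] TupleChain m (Flat n) :=
  match m with
  | 0 => LinearMap.toSpanSingleton ℤ (TupleChain 0 (Flat n)) (Finsupp.single Fin.elim0 1)
  | k + 1 => (simplexDesc (X := titsComplex n) (k := k) fun x =>
      (Finsupp.single (flagOf x) 1 : TupleChain (k + 1) (Flat n))).hom

theorem toFlags_succ_simplexChain {n k : ℕ} (x : (titsComplex n) _⦋k⦌) :
    toFlags (k + 1) (simplexChain x) = Finsupp.single (flagOf x) 1 :=
  simplexDesc_simplexChain _ x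

theorem toFlags_zero_one {n : ℕ} :
    toFlags (n := n) 0 (1 : ℤ) = Finsupp.single Fin.elim0 1 :=
  one_smul ℤ (Finsupp.single Fin.elim0 1 : TupleChain 0 (Flat n))

open Classical in
/-- The simplicial chain given by a chain of flags. -/
def ofFlags {n : ℕ} (m : ℕ) :
    TupleChain m (Flat n) →ₗ[ℤ] (augmentedChainComplex (titsComplex n)).X m :=
  match m with
  | 0 => Finsupp.linearCombination ℤ (M := (augmentedChainComplex (titsComplex n)).X 0)
      fun _ => (1 : ℤ)
  | k + 1 => Finsupp.linearCombination ℤ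
      (M := (augmentedChainComplex (titsComplex n)).X (k + 1)) fun u =>
      if hu : IsFlag u then simplexChain (simplexOf u hu) else 0

theorem ofFlags_succ_single {n k : ℕ} (u : Fin (k + 1) → Flat n) (hu : IsFlag u) :
    ofFlags (k + 1) (Finsupp.single u 1) = simplexChain (simplexOf u hu) :=
  (ModuleCat.linearCombination_single_one _ u).trans (dif_pos hu)

theorem ofFlags_zero_single {n : ℕ} (u : Fin 0 → Flat n) :
    ofFlags 0 (Finsupp.single u 1) = (1 : ℤ) :=
  ModuleCat.linearCombination_single_one _ u

/-- With `toFlags_ofFlags` and `toFlags_mem`, this identifies augmented simplicial chains with tuple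
chains supported on flags; the empty tuple accounts for the augmentation. -/
theorem ofFlags_toFlags {n m : ℕ} (z : (augmentedChainComplex (titsComplex n)).X m) :
    ofFlags m (toFlags m z) = z := by
  suffices h : ofFlags m ∘ₗ toFlags (n := n) m = LinearMap.id from LinearMap.congr_fun h z
  cases m with
  | zero =>
    refine LinearMap.ext_ring (R := ℤ) ?_
    refine (congrArg (ofFlags (n := n) 0) toFlags_zero_one).trans ?_
    exact ofFlags_zero_single _
  | succ k =>
    refine simplexChain_hom_ext (X := titsComplex n) fun x => ?_
    refine (congrArg (ofFlags (k + 1)) (toFlags_succ_simplexChain x)).trans ?_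
    rw [ofFlags_succ_single _ (isFlag_flagOf x), simplexOf_flagOf]
    rfl

theorem toFlags_ofFlags {n m : ℕ} {z : TupleChain m (Flat n)} (hz : z ∈ on IsFlag) :
    toFlags m (ofFlags m z) = z := by
  refine map_eq_of_on (f := toFlags m ∘ₗ ofFlags m) (g := LinearMap.id) (fun u hu => ?_) hz
  cases m with
  | zero =>
    refine (congrArg (toFlags (n := n) 0) (ofFlags_zero_single u)).trans ?_
    rw [toFlags_zero_one, Subsingleton.elim Fin.elim0 u]
    rfl
  | succ k =>
    refine (congrArg (toFlags (k + 1)) (ofFlags_succ_single u hu)).trans ?_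
    rw [toFlags_succ_simplexChain, flagOf_simplexOf]
    rfl

theorem toFlags_injective {n m : ℕ} : Function.Injective (toFlags (n := n) m) :=
  Function.LeftInverse.injective ofFlags_toFlags

theorem toFlags_mem {n m : ℕ} (z : (augmentedChainComplex (titsComplex n)).X m) :
    toFlags m z ∈ on IsFlag := by
  suffices h : (on IsFlag).mkQ ∘ₗ toFlags (n := n) m = 0 from
    (Submodule.Quotient.mk_eq_zero _).1 (LinearMap.congr_fun h z)
  cases m with
  | zero =>
    refine LinearMap.ext fun w => (Submodule.Quotient.mk_eq_zero _).2 ?_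
    exact (Finsupp.mem_supported' ℤ _).2 fun u hu =>
      absurd ⟨fun i => i.elim0, fun i => i.elim0⟩ hu
  | succ k =>
    refine simplexChain_hom_ext (X := titsComplex n) (M := ModuleCat.of ℤ _) fun x => ?_
    refine (Submodule.Quotient.mk_eq_zero _).2 ?_
    rw [toFlags_succ_simplexChain]
    exact single_mem_on (isFlag_flagOf x)

theorem toFlags_d {n m : ℕ} (z : (augmentedChainComplex (titsComplex n)).X (m + 1)) :
    toFlags m (((augmentedChainComplex (titsComplex n)).d (m + 1) m).hom z) =
      d m (toFlags (m + 1) z) := by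
  suffices h : toFlags m ∘ₗ ((augmentedChainComplex (titsComplex n)).d (m + 1) m).hom =
      d m ∘ₗ toFlags (n := n) (m + 1) from LinearMap.congr_fun h z
  refine simplexChain_hom_ext (X := titsComplex n) (M := ModuleCat.of ℤ _) fun x => ?_
  refine Eq.trans ?_ (congrArg (d m) (toFlags_succ_simplexChain x)).symm
  rw [d_single]
  cases m with
  | zero =>
    refine (congrArg (toFlags (n := n) 0) (augmentation_simplexChain x)).trans ?_
    rw [toFlags_zero_one, Fin.sum_univ_one]
    simp [Subsingleton.elim (flagOf x ∘ _) Fin.elim0]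
  | succ k =>
    refine (congrArg (toFlags (k + 1)) (d_simplexChain x)).trans ?_
    refine (map_sum _ _ _).trans (Finset.sum_congr rfl fun i _ => ?_)
    refine (map_zsmul _ _ _).trans (congrArg _ ?_)
    refine (toFlags_succ_simplexChain _).trans ?_
    congr 1

theorem toFlags_map {n m : ℕ} (g : EuclIsom n)
    (z : (augmentedChainComplex (titsComplex n)).X m) :
    toFlags m (((augmentedChainComplexMap (titsMap g)).f m).hom z) =
      push (AffineSubspace.map (isomAffine g)) (toFlags m z) := by
  suffices h : toFlags m ∘ₗ ((augmentedChainComplexMap (titsMap g)).f m).hom =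
      push (AffineSubspace.map (isomAffine g)) ∘ₗ toFlags (n := n) m from
    LinearMap.congr_fun h z
  cases m with
  | zero =>
    refine LinearMap.ext_ring (R := ℤ) ?_
    refine Eq.trans ?_ (congrArg (push _) toFlags_zero_one).symm
    refine toFlags_zero_one.trans ?_
    rw [push_single]
    exact congrArg (fun v => Finsupp.single v 1) (Subsingleton.elim _ _)
  | succ k =>
    refine simplexChain_hom_ext (X := titsComplex n) (M := ModuleCat.of ℤ _) fun x => ?_
    refine Eq.trans ?_ (congrArg (push _) (toFlags_succ_simplexChain x)).symm
    refine (congrArg (toFlags (k + 1)) (map_simplexChain (titsMap g) x)).trans ?_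
    rw [toFlags_succ_simplexChain, push_single]
    rfl

theorem isCycle_toFlags {n m : ℕ} {z : (augmentedChainComplex (titsComplex n)).X m}
    (hz : ((augmentedChainComplex (titsComplex n)).d m
      ((ComplexShape.down ℕ).next m)).hom z = 0) : IsCycle (toFlags m z) := by
  cases m with
  | zero => trivial
  | succ m =>
    rw [ChainComplex.next_nat_succ] at hz
    change d m (toFlags (m + 1) z) = 0
    rw [← toFlags_d, hz, map_zero]

theorem d_eq_zero_of_isCycle {n m : ℕ} {z : (augmentedChainComplex (titsComplex n)).X m}
    (hz : IsCycle (toFlags m z)) : ((augmentedChainComplex (titsComplex n)).d m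
      ((ComplexShape.down ℕ).next m)).hom z = 0 := by
  cases m with
  | zero =>
    -- There is no differential out of index `0`, so everything there is a cycle, in agreement with
    -- `IsCycle`.
    rw [HomologicalComplex.shape _ _ _ (by simp)]
    rfl
  | succ m =>
    change d m (toFlags (m + 1) z) = 0 at hz
    rw [ChainComplex.next_nat_succ]
    rw [← toFlags_d] at hz
    exact toFlags_injective (hz.trans (map_zero _).symm)

theorem exists_d_eq_of_toFlags {n m : ℕ} {z : (augmentedChainComplex (titsComplex n)).X m}
    (h : ∃ w ∈ on IsFlag, toFlags m z = d m w) :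
    ∃ w, ((augmentedChainComplex (titsComplex n)).d (m + 1) m).hom w = z := by
  obtain ⟨w, hw, e⟩ := h
  refine ⟨ofFlags (m + 1) w, toFlags_injective ?_⟩
  rw [toFlags_d, toFlags_ofFlags hw, e]

/-! ## The main theorem -/

theorem subsingleton_titsHomology {n m : ℕ} (h : m ≠ n) : Subsingleton (TitsHomology n m) := by
  refine subsingleton_homology_of_forall_exists _ m fun z hz => exists_d_eq_of_toFlags ?_
  have hc := isCycle_toFlags hz
  have hF := toFlags_mem z
  rcases lt_or_gt_of_ne h with h | h
  · exact exists_d_eq_of_lt h hc hF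
  · refine exists_d_eq_of_degenerate hc hF ?_
    exact on_mono (fun u hu => hu.degenerate_of_lt h) hF

/-- The homomorphism from simplicial chains of the Tits complex to the polytope module. -/
def titsEval {n : ℕ} (a : Flat n → EuclSpace n) :
    (augmentedChainComplex (titsComplex n)).X n ⟶ ModuleCat.of ℤ (PolytopeModule n) :=
  ModuleCat.ofHom (evalFlag 0 a ∘ₗ toFlags n)

theorem titsEval_apply {n : ℕ} (a : Flat n → EuclSpace n)
    (z : (augmentedChainComplex (titsComplex n)).X n) :
    (titsEval a).hom z = evalFlag 0 a (toFlags n z) := rfl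

theorem d_titsEval {n : ℕ} {a : Flat n → EuclSpace n} (ha : IsSection a) :
    (augmentedChainComplex (titsComplex n)).d (n + 1) n ≫ titsEval a = 0 := by
  refine ModuleCat.hom_ext (LinearMap.ext fun z => ?_)
  refine (titsEval_apply a _).trans ?_
  exact (congrArg (evalFlag 0 a) (toFlags_d z)).trans (evalFlag_d 0 ha (toFlags_mem z))

theorem titsEval_map {n : ℕ} {a : Flat n → EuclSpace n} (ha : IsSection a) (g : EuclIsom n)
    (x : TitsHomology n n) :
    (homologyDesc (titsEval a) (d_titsEval ha)).hom (signTwist (titsRep n n) g x) =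
      polytopeRep n g ((homologyDesc (titsEval a) (d_titsEval ha)).hom x) := by
  obtain ⟨z, rfl⟩ := homologyπ_surjective x
  have h1 : signTwist (titsRep n n) g
      (((augmentedChainComplex (titsComplex n)).homologyπ n).hom z) =
      isomSign n g • ((augmentedChainComplex (titsComplex n)).homologyπ n).hom
        ((HomologicalComplex.cyclesMap (augmentedChainComplexMap (titsMap g)) n).hom z) :=
    congrArg (isomSign n g • ·) (LinearMap.congr_fun (congrArg ModuleCat.Hom.hom
      (HomologicalComplex.homologyπ_naturality (augmentedChainComplexMap (titsMap g)) n)) z)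
  have h2 : ((augmentedChainComplex (titsComplex n)).iCycles n).hom
      ((HomologicalComplex.cyclesMap (augmentedChainComplexMap (titsMap g)) n).hom z) =
      ((augmentedChainComplexMap (titsMap g)).f n).hom
        (((augmentedChainComplex (titsComplex n)).iCycles n).hom z) :=
    LinearMap.congr_fun (congrArg ModuleCat.Hom.hom
      (HomologicalComplex.cyclesMap_i (augmentedChainComplexMap (titsMap g)) n)) z
  -- The sign from the twist meets the orientation sign in `evalFlag_push`, and the two cancel.
  have hs : isomSign n g * isomSign n g = 1 := by
    rcases Int.isUnit_iff.1 ((Group.isUnit g).map (isomSign n)) with h | h <;> rw [h] <;> rfl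
  rw [h1, map_zsmul, homologyDesc_homologyπ, homologyDesc_homologyπ, h2, titsEval_apply,
    titsEval_apply, toFlags_map, evalFlag_push g 0 ha (isCycle_toFlags (d_iCycles z))
      (toFlags_mem _), smul_smul, hs, one_smul]

theorem titsEval_bijective {n : ℕ} {a : Flat n → EuclSpace n} (ha : IsSection a) :
    Function.Bijective (homologyDesc (titsEval a) (d_titsEval ha)).hom := by
  constructor
  · refine homologyDesc_injective _ _ fun z hz h => exists_d_eq_of_toFlags ?_
    exact exists_d_eq_of_evalFlag_eq_zero ha (isCycle_toFlags hz) (toFlags_mem z) h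
  · refine LinearMap.range_eq_top.1 (polytopeModule_induction fun y hy => ?_)
    obtain ⟨z, hzF, hz, e⟩ := exists_evalFlag_eq_simplexClass 0 ha y
    obtain ⟨c, hc⟩ := exists_iCycles_eq (K := augmentedChainComplex (titsComplex n))
      (z := ofFlags n z) (d_eq_zero_of_isCycle (by rwa [toFlags_ofFlags hzF]))
    have hmem : simplexClass y ∈
        LinearMap.range (homologyDesc (titsEval a) (d_titsEval ha)).hom := by
      refine ⟨((augmentedChainComplex (titsComplex n)).homologyπ n).hom c, ?_⟩
      rw [homologyDesc_homologyπ, hc, titsEval_apply, toFlags_ofFlags hzF, e]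
    -- The orientation sign of an independent tuple is `±1`, so the unoriented class is a multiple
    -- of the oriented one.
    have hs : polytopeClass (convexHull ℝ (Set.range y)) =
        ((SignType.sign (orientDet y) : SignType) : ℤ) • simplexClass y := by
      rw [simplexClass, smul_smul]
      rcases lt_or_gt_of_ne ((orientDet_ne_zero_iff y).2 hy) with h | h <;> simp [h]
    rw [hs]
    exact Submodule.smul_mem _ _ hmem

end

theorem mainTheorem2 (n : ℕ) :
    Nonempty ((signTwist (titsRep n n)).Equiv (polytopeRep n)) ∧
      ∀ m : ℕ, m ≠ n → Subsingleton (TitsHomology n m) := by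
  refine ⟨?_, fun m h => subsingleton_titsHomology h⟩
  obtain ⟨a, ha⟩ := exists_isSection n
  exact ⟨.mk (LinearEquiv.ofBijective _ (titsEval_bijective ha)) fun g =>
    LinearMap.ext fun x => titsEval_map ha g x⟩
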